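/- A cookie environment is an element $\omega\in[0,1]^{\mathbb Z\times\mathbb N}$ (with the product $\sigma$-algebra, $\mathbb N=\{1,2,\dots\}$), and an arrow environment is an element $a\in\{-1,1\}^{\mathbb Z\times\mathbb N}$. Given a probability measure $P$ on cookie environments, let $\mathbb P$ be the law of the arrow environment $a$ obtained by sampling $\omega$ from $P$ and then letting, conditionally on $\omega$, the arrows be independent with $a(x,n)=1$ with probability $\omega(x,n)$ and $a(x,n)=-1$ otherwise. A $k$-mob walk ($k\ge1$) on $a$ with initial positions $x_1,\dots,x_k\in\mathbb Z$ moves $k$ walkers one at a time, following a fixed schedule $S:\{0,1,2,\dots\}\to\{1,\dots,k\}$ that takes each value infinitely often: at time $t$ walker $S(t)$, located at some $x$, makes the step $a(x,n)$, where this is the $n$-th departure of a walker from $x$. The environment $a$ is $k$-right transient with respect to $x_1,\dots,x_k$ if all walkers go to $+\infty$ (for every such schedule), and $P$ is so if this holds $\mathbb P$-a.s.; $P$ is strongly $k$-right transient if, $\mathbb P$-a.s., $a$ is $k$-right transient with respect to all $k$-tuples of initial positions. Let $L^{x_1,\dots,x_k}(y)$ be the total number of departures from $y$ in the mob walk, and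 set $$LO^{x_1,\dots,x_k}(a)(y,i)=a\big(y,i+L^{x_1,\dots,x_k}(y)\big),\qquad LO^{k\text{-limit}}(a)(y,i)=LO^{y,\dots,y}(a)(y,i),$$ the first being defined when $a$ is $k$-right transient with respect to $x_1,\dots,x_k$, the second when $a$ is strongly $k$-right transient. Let $P_{LO}^{x_1,\dots,x_k}$ and $P_{LO}^{k\text{-limit}}$ be the laws of these arrow environments under $\mathbb P$. A law of arrow environments is transient to the right if almost surely the single walk started from $0$ tends to $+\infty$. **Proposition.** Let $k\ge1$ and let $P$ be a probability measure on cookie environments such that * (SE) $P$ is stationary and ergodic with respect to the shift on $\mathbb Z$; * (ND) $P$-a.s., $\sum_{n}\omega(x,n)=\infty$ and $\sum_{n}(1-\omega(x,n))=\infty$ for all $x\in\mathbb Z$; * (WEL) $P(\omega(x,n)>0\ \forall n)>0$ and $P(\omega(x,n)<1\ \forall n)>0$ for all $x\in\mathbb Z$. The following are equivalent, for any choice of the schedule used to define the leftover environments: 1. $P$ is strongly $(k+1)$-right transient. 2. There are $x_1,\dots,x_k\in\mathbb Z$ such that $P$ is $k$-right transient with respect to $x_1,\dots,x_k$ and $P_{LO}^{x_1,\dots,x_k}$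 is transient to the right. 3. $P$ is strongly $k$-right transient and $P_{LO}^{k\text{-limit}}$ is transient to the right. Moreover, when these conditions hold, there is a constant $v\in\mathbb R$ such that for $\mathbb P$-a.e. $a$ the walk started from $0$ on $LO^{k\text{-limit}}(a)$ and, for all $x_1,\dots,x_k\in\mathbb Z$, the walk started from $0$ on $LO^{x_1,\dots,x_k}(a)$ have speed $v$, i.e. $X_n/n\to v$. -/

import Mathlib

open MeasureTheory ProbabilityTheory Filter Topology unitInterval

/-- Cookie environments: `ω (x, n) ∈ [0,1]` is the strength of the cookie used on the `(n+1)`-st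
visit to the site `x` (cookies are counted from `0`).  The σ-algebra is the product one. -/
abbrev CookieEnv : Type := ℤ × ℕ → I

/-- Arrow environments: `a (x, n)` is the direction taken from the site `x` on the `(n+1)`-st visit,
`true` standing for `+1` and `false` for `-1`. -/
abbrev ArrowEnv : Type := ℤ × ℕ → Bool

/-- The left shift on cookie environments. -/
def cookieShift (ω : CookieEnv) : CookieEnv := fun p => ω (p.1 + 1, p.2)

/-- (SE): the family of cookie stacks is stationary and ergodic with respect to the shift on `ℤ`. -/
def StationaryErgodic (P : Measure CookieEnv) : Prop := Ergodic cookieShift P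

/-- (ND): almost surely, at each site, `∑ ω(x,n) = ∞` and `∑ (1 - ω(x,n)) = ∞`. -/
def NonDegenerate (P : Measure CookieEnv) : Prop :=
  ∀ᵐ ω ∂P, ∀ x : ℤ, ¬ Summable (fun n : ℕ => (ω (x, n) : ℝ)) ∧
    ¬ Summable (fun n : ℕ => 1 - (ω (x, n) : ℝ))

/-- (WEL): weak ellipticity. -/
def WeaklyElliptic (P : Measure CookieEnv) : Prop :=
  ∀ x : ℤ, 0 < P {ω | ∀ n : ℕ, 0 < ω (x, n)} ∧ 0 < P {ω | ∀ n : ℕ, ω (x, n) < 1}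

/-- The quenched law on arrow environments: the arrows are independent, and the arrow at `(x, n)`
points to the right with probability `ω (x, n)`. -/
noncomputable def quenchedArrowLaw (ω : CookieEnv) : Measure ArrowEnv :=
  Measure.infinitePi fun p : ℤ × ℕ => bernoulliMeasure true false (ω p)

instance (ω : CookieEnv) : IsProbabilityMeasure (quenchedArrowLaw ω) := by
  unfold quenchedArrowLaw; infer_instance

theorem measurable_quenchedArrowLaw : Measurable quenchedArrowLaw := by
  refine Measurable.measure_of_isPiSystem_of_isProbabilityMeasure
    (generateFrom_squareCylinders (α := fun _ : ℤ × ℕ => Bool)).symm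
    (isPiSystem_squareCylinders (fun _ => MeasurableSpace.isPiSystem_measurableSet)
      (fun _ => Set.mem_ofPred.2 MeasurableSet.univ)) ?_
  rintro _ ⟨s, t, ht, rfl⟩
  have ht' : ∀ p ∈ s, MeasurableSet (t p) := fun p _ => ht p (Set.mem_univ p)
  have h : ∀ ω : CookieEnv, quenchedArrowLaw ω ((s : Set (ℤ × ℕ)).pi t)
      = ∏ p ∈ s, bernoulliMeasure true false (ω p) (t p) := fun ω =>
    Measure.infinitePi_pi _ ht'
  simp_rw [h]
  refine Finset.measurable_prod _ fun p _ => ?_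
  have hb : Measurable fun q : I => bernoulliMeasure true false q (t p) := by
    simp only [bernoulliMeasure_def, Measure.add_apply, Measure.smul_apply]
    refine Measurable.add (Measurable.smul_const ?_ _) (Measurable.smul_const ?_ _)
    · exact (by fun_prop : Continuous fun q : I => toNNReal q).measurable
    · exact (by fun_prop : Continuous fun q : I => toNNReal (unitInterval.symm q)).measurable
  exact hb.comp (measurable_pi_apply p)

/-- The annealed law on arrow environments: the `P`-average of the quenched laws. -/
noncomputable def annealedArrowLaw (P : Measure CookieEnv) : Measure ArrowEnv :=
  P.bind quenchedArrowLaw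

/-- The displacement prescribed by an arrow. -/
def arrowStep (b : Bool) : ℤ := if b then 1 else -1

/-- The mob walk of `k` walkers on the arrow environment `a`, started from the positions `x`, in
which walker `S t` moves at time `t`.  The state at time `t` consists of the positions of the
walkers and of the local time: the number of departures from each site before time `t`. -/
def mobState {k : ℕ} (S : ℕ → Fin k) (x : Fin k → ℤ) (a : ArrowEnv) :
    ℕ → (Fin k → ℤ) × (ℤ → ℕ)
  | 0 => (x, fun _ => 0)
  | t + 1 =>
    let X := (mobState S x a t).1
    let L := (mobState S x a t).2
    let y := X (S t)
    (Function.update X (S t) (y + arrowStep (a (y, L y))), Function.update L y (L y + 1))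

/-- A scheduling is proper if every walker is chosen infinitely often. -/
def ProperScheduling {k : ℕ} (S : ℕ → Fin k) : Prop := ∀ i, {t | S t = i}.Infinite

/-- `a` is `k`-right transient with respect to the initial positions `x`: in a `k`-mob walk on `a`
(with any proper scheduling) all the walkers go to `+∞`. -/
def MobRightTransient {k : ℕ} (x : Fin k → ℤ) (a : ArrowEnv) : Prop :=
  ∀ S : ℕ → Fin k, ProperScheduling S →
    ∀ i, Tendsto (fun t => (mobState S x a t).1 i) atTop atTop

/-- `P` is strongly `k`-right transient: almost every arrow environment is `k`-right transient with
respect to all `k`-tuples of initial positions. -/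
def StronglyRightTransient (P : Measure CookieEnv) (k : ℕ) : Prop :=
  ∀ᵐ a ∂annealedArrowLaw P, ∀ x : Fin k → ℤ, MobRightTransient x a

/-- The asymptotic local time of the mob walk. -/
noncomputable def mobLocalTime {k : ℕ} (S : ℕ → Fin k) (x : Fin k → ℤ) (a : ArrowEnv) (y : ℤ) :
    ℕ∞ :=
  ⨆ t, ((mobState S x a t).2 y : ℕ∞)

/-- The leftover environment generated by `k` walkers started from `x`
(meaningful when the local times are finite). -/
noncomputable def leftover {k : ℕ} (S : ℕ → Fin k) (x : Fin k → ℤ) (a : ArrowEnv) : ArrowEnv :=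
  fun p => a (p.1, p.2 + (mobLocalTime S x a p.1).toNat)

/-- The stationary `k`-leftover environment: above the site `y` it is the leftover environment
generated by `k` walkers all started from `y`. -/
noncomputable def limitLeftover {k : ℕ} (S : ℕ → Fin k) (a : ArrowEnv) : ArrowEnv :=
  fun p => leftover S (fun _ => p.1) a p

/-- The (single) walk on an arrow environment, started from `0`. -/
def walk (a : ArrowEnv) (t : ℕ) : ℤ :=
  (mobState (fun _ => (0 : Fin 1)) (fun _ => 0) a t).1 0

/-- The walk started from `0` goes to `+∞`. -/
def WalkRightTransient (a : ArrowEnv) : Prop := Tendsto (walk a) atTop atTop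

/-- The law of the leftover environment generated by `k` walkers started from `x`. -/
noncomputable def leftoverLaw (P : Measure CookieEnv) {k : ℕ} (S : ℕ → Fin k) (x : Fin k → ℤ) :
    Measure ArrowEnv :=
  (annealedArrowLaw P).map (leftover S x)

/-- The law of the stationary `k`-leftover environment. -/
noncomputable def limitLeftoverLaw (P : Measure CookieEnv) {k : ℕ} (S : ℕ → Fin k) :
    Measure ArrowEnv :=
  (annealedArrowLaw P).map (limitLeftover S)

/-- Evaluating a measurable random function at a measurable random point of a countable set. -/
theorem measurable_eval_countable {α ι β : Type*} [MeasurableSpace α] [MeasurableSpace ι]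
    [Countable ι] [MeasurableSingletonClass ι] [MeasurableSpace β] {f : α → ι → β} {g : α → ι}
    (hf : ∀ i, Measurable fun a => f a i) (hg : Measurable g) : Measurable fun a => f a (g a) :=
  (measurable_from_prod_countable_left (f := fun q : α × ι => f q.1 q.2) hf).comp
    (measurable_id.prodMk hg)

theorem measurable_mobState {k : ℕ} (S : ℕ → Fin k) (x : Fin k → ℤ) (t : ℕ) :
    (∀ i, Measurable fun a : ArrowEnv => (mobState S x a t).1 i) ∧
      ∀ y, Measurable fun a : ArrowEnv => (mobState S x a t).2 y := by
  induction t with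
  | zero => exact ⟨fun i => measurable_const, fun y => measurable_const⟩
  | succ t ih =>
    obtain ⟨hX, hL⟩ := ih
    have hLy := measurable_eval_countable hL (hX (S t))
    have ha : Measurable fun a : ArrowEnv =>
        a ((mobState S x a t).1 (S t), (mobState S x a t).2 ((mobState S x a t).1 (S t))) :=
      measurable_eval_countable (f := fun (a : ArrowEnv) p => a p)
        (fun p => measurable_pi_apply p) ((hX (S t)).prodMk hLy)
    have hstep : Measurable arrowStep := measurable_of_countable _
    constructor
    · intro i
      simp only [mobState, Function.update_apply]
      by_cases hi : i = S t
      · simp only [hi, if_true]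
        exact (hX (S t)).add (hstep.comp ha)
      · simp only [hi, if_false]
        exact hX i
    · intro y
      simp only [mobState, Function.update_apply]
      refine Measurable.ite ?_ (hLy.add measurable_const) (hL y)
      exact measurableSet_eq_fun measurable_const (hX (S t))

theorem measurable_mobLocalTime {k : ℕ} (S : ℕ → Fin k) (x : Fin k → ℤ) (y : ℤ) :
    Measurable fun a : ArrowEnv => mobLocalTime S x a y := by
  have hle : ∀ c : ℕ∞, MeasurableSet {a : ArrowEnv | mobLocalTime S x a y ≤ c} := by
    intro c
    simp only [mobLocalTime, iSup_le_iff, Set.ofPred_forall]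
    exact MeasurableSet.iInter fun t =>
      (measurable_mobState S x t).2 y (MeasurableSet.of_discrete (s := {n : ℕ | (n : ℕ∞) ≤ c}))
  refine measurable_to_countable' fun c => ?_
  have h : (fun a : ArrowEnv => mobLocalTime S x a y) ⁻¹' {c}
      = {a | mobLocalTime S x a y ≤ c} ∩ ⋂ d ∈ Set.Iio c, {a | mobLocalTime S x a y ≤ d}ᶜ := by
    ext a
    simp only [Set.mem_preimage, Set.mem_singleton_iff, Set.mem_inter_iff, Set.mem_ofPred_eq,
      Set.mem_iInter, Set.mem_Iio, Set.mem_compl_iff, not_le]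
    constructor
    · rintro rfl
      exact ⟨le_rfl, fun d hd => hd⟩
    · rintro ⟨h1, h2⟩
      by_contra hne
      exact lt_irrefl _ (h2 _ (lt_of_le_of_ne h1 hne))
  rw [h]
  exact (hle c).inter (MeasurableSet.biInter (Set.to_countable _) fun d _ => (hle d).compl)

theorem measurable_leftover_apply {k : ℕ} (S : ℕ → Fin k) (x : Fin k → ℤ) (p : ℤ × ℕ) :
    Measurable fun a : ArrowEnv => leftover S x a p :=
  measurable_eval_countable (f := fun (a : ArrowEnv) p => a p) (fun p => measurable_pi_apply p)
    (measurable_const.prodMk (measurable_const.add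
      ((measurable_of_countable ENat.toNat).comp (measurable_mobLocalTime S x p.1))))

theorem measurable_leftover {k : ℕ} (S : ℕ → Fin k) (x : Fin k → ℤ) :
    Measurable (leftover S x) :=
  measurable_pi_lambda _ (measurable_leftover_apply S x)

theorem measurable_limitLeftover {k : ℕ} (S : ℕ → Fin k) :
    Measurable (limitLeftover S) :=
  measurable_pi_lambda _ fun p => measurable_leftover_apply S (fun _ => p.1) p

/-! Everything rests on a flow balance: the number of walkers to the right of `y` changes only
through right arrows used at `y` and left arrows used at `y + 1`. A finite profile `N` satisfying
`SuperSol k m` therefore bounds the local times of every `k`-mob on `[m, ∞)`, whatever the schedule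
and the starting points (`SuperSol.localTime_le`). The departures of a transient mob started left of
`m` form such a profile themselves, hence the smallest one. This yields independence of the
schedule, and the comparison of `k + 1` walkers with `k` walkers followed by one walker on the
leftover: profiles can be subtracted (`SuperSol.leftover`) and added
(`superSol_add_walkDepartures`).

A barrier is a site `z` carrying a profile on `[z, ∞)` whose first `N z` arrows at `z` all point
right; no walker of the mob located at or beyond `z` ever gets below it. Barriers arbitrarily far to
the left force transience for all starting points and schedules. Each of the three conditions turns
out to be equivalent to almost sure `HasBarriers (k + 1)`. Indeed each gives almost surely a profile
of order `k + 1` on some half-line; weak ellipticity allows the bottom arrows just left of it to be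
turned right with positive probability, which makes a barrier; ergodicity of the annealed law,
inherited from `P`, then repeats barriers towards `-∞` (`StationaryErgodic.ae_hasBarriers`).

For the speed, the departures of the extra walker from `y`, to the right of all starting points, are
a fixed function of the environment translated by `y`. Barriers have positive density, and a barrier
is passed for good at a time equal to the sum of departures from the sites on its left. Birkhoff's
theorem gives the asymptotics of this sum, and interpolation between barriers gives the speed. -/

/-! ### Counting arrows in a stack -/

/-- The number of right arrows among the first `n` arrows above `y`. -/
def rightCount (a : ArrowEnv) (y : ℤ) (n : ℕ) : ℕ := Nat.count (fun i => a (y, i) = true) n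

/-- The number of left arrows among the first `n` arrows above `y`. -/
def leftCount (a : ArrowEnv) (y : ℤ) (n : ℕ) : ℕ := Nat.count (fun i => a (y, i) = false) n

theorem leftCount_mono (a : ArrowEnv) (y : ℤ) : Monotone (leftCount a y) :=
  Nat.count_monotone _

theorem rightCount_succ (a : ArrowEnv) (y : ℤ) (n : ℕ) :
    rightCount a y (n + 1) = rightCount a y n + if a (y, n) = true then 1 else 0 :=
  Nat.count_succ _ _

theorem leftCount_succ (a : ArrowEnv) (y : ℤ) (n : ℕ) :
    leftCount a y (n + 1) = leftCount a y n + if a (y, n) = false then 1 else 0 :=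
  Nat.count_succ _ _

theorem leftCount_eq_zero_iff {a : ArrowEnv} {y : ℤ} {n : ℕ} :
    leftCount a y n = 0 ↔ ∀ i < n, a (y, i) = true := by
  induction n with
  | zero => simp [leftCount]
  | succ n ih =>
    rw [leftCount_succ, Nat.add_eq_zero_iff, ih]
    constructor
    · rintro ⟨h1, h2⟩ i hi
      rcases Nat.lt_succ_iff_lt_or_eq.1 hi with h | rfl
      · exact h1 i h
      · simpa using h2
    · intro h
      exact ⟨fun i hi => h i (hi.trans n.lt_succ_self), by simp [h n n.lt_succ_self]⟩

theorem rightCount_add_leftCount (a : ArrowEnv) (y : ℤ) (n : ℕ) :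
    rightCount a y n + leftCount a y n = n := by
  induction n with
  | zero => simp [leftCount, rightCount]
  | succ n ih =>
    rw [leftCount_succ, rightCount_succ]
    cases h : a (y, n) <;> simp <;> omega

/-! ### Conservation of walkers and the least action principle -/

section Mob

variable {k : ℕ} (S : ℕ → Fin k) (x : Fin k → ℤ) (a : ArrowEnv)

theorem mobState_succ_fst (t : ℕ) (i : Fin k) :
    (mobState S x a (t + 1)).1 i =
      if i = S t then (mobState S x a t).1 (S t) + arrowStep (a ((mobState S x a t).1 (S t),
        (mobState S x a t).2 ((mobState S x a t).1 (S t)))) else (mobState S x a t).1 i := by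
  simp only [mobState, Function.update_apply]

theorem mobState_succ_snd (t : ℕ) (y : ℤ) :
    (mobState S x a (t + 1)).2 y =
      (mobState S x a t).2 y + if (mobState S x a t).1 (S t) = y then 1 else 0 := by
  simp only [mobState, Function.update_apply]
  by_cases h : y = (mobState S x a t).1 (S t)
  · subst h; simp
  · simp [h, Ne.symm h]

/-- The number of walkers to the right of `y` changes only through arrows at `y` and `y + 1`. -/
theorem mobState_balance (t : ℕ) (y : ℤ) :
    (Finset.univ.filter fun i => y < (mobState S x a t).1 i).card +
        leftCount a (y + 1) ((mobState S x a t).2 (y + 1)) =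
      (Finset.univ.filter fun i => y < x i).card + rightCount a y ((mobState S x a t).2 y) := by
  induction t with
  | zero => simp only [mobState, leftCount, rightCount, Nat.count_zero]; rfl
  | succ t ih =>
    rw [Finset.card_filter, ← Finset.add_sum_erase _ _ (Finset.mem_univ (S t))] at ih ⊢
    have hs : ∑ i ∈ Finset.univ.erase (S t), (if y < (mobState S x a (t + 1)).1 i then 1 else 0)
        = ∑ i ∈ Finset.univ.erase (S t), (if y < (mobState S x a t).1 i then 1 else 0) := by
      refine Finset.sum_congr rfl fun i hi => ?_
      rw [mobState_succ_fst, if_neg (Finset.ne_of_mem_erase hi)]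
    rw [hs, mobState_succ_snd, mobState_succ_snd, mobState_succ_fst, if_pos rfl]
    generalize hp : (mobState S x a t).1 (S t) = p at *
    generalize (mobState S x a t).2 = L at *
    by_cases h1 : p = y
    · subst h1
      have h2 : ¬ p = p + 1 := by omega
      rw [if_pos rfl, if_neg h2, rightCount_succ]
      cases h : a (p, L p) <;> simp [arrowStep] at ih ⊢ <;> omega
    · by_cases h2 : p = y + 1
      · subst h2
        rw [if_pos rfl, if_neg h1, leftCount_succ]
        cases h : a (y + 1, L (y + 1)) <;> simp [arrowStep] at ih ⊢
        · omega
        · exact ih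
      · rw [if_neg h1, if_neg h2]
        have : y < p + arrowStep (a (p, L p)) ↔ y < p := by
          cases h : a (p, L p) <;> simp [arrowStep] <;> omega
        simp only [this, Nat.add_zero]
        exact ih

/-- `N` bounds the local times on `[m, ∞)` of any `j`-mob walk: out of the first `N y` arrows at
`y`, at least `j` more point to the right than left arrows come from `y + 1`. -/
def SuperSol (j : ℕ) (m : ℤ) (a : ArrowEnv) (N : ℤ → ℕ) : Prop :=
  ∀ y, m ≤ y → j + leftCount a (y + 1) (N (y + 1)) ≤ rightCount a y (N y)

variable {S x a}

theorem SuperSol.mono {j j' : ℕ} {m m' : ℤ} {N : ℤ → ℕ} (h : SuperSol j m a N) (hj : j' ≤ j)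
    (hm : m ≤ m') : SuperSol j' m' a N := fun y hy =>
  (Nat.add_le_add_right hj _).trans (h y (hm.trans hy))

theorem leftCount_congr {b : ArrowEnv} {y : ℤ} (h : ∀ i, a (y, i) = b (y, i)) (n : ℕ) :
    leftCount a y n = leftCount b y n := by
  simp [leftCount, h]

theorem rightCount_congr {b : ArrowEnv} {y : ℤ} (h : ∀ i, a (y, i) = b (y, i)) (n : ℕ) :
    rightCount a y n = rightCount b y n := by
  simp [rightCount, h]

theorem SuperSol.congr {b : ArrowEnv} {j : ℕ} {m : ℤ} {N : ℤ → ℕ} (h : SuperSol j m a N)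
    (hab : ∀ y, m ≤ y → ∀ i, a (y, i) = b (y, i)) : SuperSol j m b N := fun y hy => by
  rw [← rightCount_congr (hab y hy), ← leftCount_congr (hab (y + 1) (by omega))]
  exact h y hy

/-- Least action principle. Consider the first departure that would break the bound, from `y` with
`N y` arrows already used. The balance and the supersolution inequality then put at least `k`
walkers strictly to the right of `y`, although the moving walker stands at `y`. -/
theorem SuperSol.localTime_le {m : ℤ} {N : ℤ → ℕ} (h : SuperSol k m a N) (t : ℕ) {y : ℤ}
    (hy : m ≤ y) : (mobState S x a t).2 y ≤ N y := by
  induction t generalizing y with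
  | zero => simp [mobState]
  | succ t ih =>
    rw [mobState_succ_snd]
    split_ifs with hp
    · refine Nat.lt_of_le_of_ne (ih hy) fun he => ?_
      have hb := mobState_balance S x a t y
      have h1 := h y hy
      have h2 := leftCount_mono a (y + 1) (ih (y := y + 1) (by omega))
      have h3 : (Finset.univ.filter fun i => y < (mobState S x a t).1 i).card < k := by
        conv_rhs => rw [← Fintype.card_fin k, ← Finset.card_univ]
        refine Finset.card_lt_card (Finset.filter_ssubset.2 ⟨S t, Finset.mem_univ _, ?_⟩)
        omega
      rw [he] at hb
      omega
    · exact ih hy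

theorem mobState_snd_mono (y : ℤ) : Monotone fun t => (mobState S x a t).2 y :=
  monotone_nat_of_le_succ fun t => by rw [mobState_succ_snd]; omega

/-- The total number of departures from `y`, as a natural number. -/
noncomputable def totalDepartures (S : ℕ → Fin k) (x : Fin k → ℤ) (a : ArrowEnv) (y : ℤ) : ℕ :=
  (mobLocalTime S x a y).toNat

theorem totalDepartures_eq {y : ℤ} {T : ℕ}
    (h : ∀ t, T ≤ t → (mobState S x a t).2 y = (mobState S x a T).2 y) :
    totalDepartures S x a y = (mobState S x a T).2 y := by
  have : mobLocalTime S x a y = ((mobState S x a T).2 y : ℕ∞) := by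
    refine le_antisymm (iSup_le fun t => ?_) (le_iSup (fun t => ((mobState S x a t).2 y : ℕ∞)) T)
    rw [← h (max t T) (le_max_right _ _)]
    exact Nat.cast_le.2 (mobState_snd_mono y (le_max_left _ _))
  rw [totalDepartures, this, ENat.toNat_natCast]

theorem exists_eventually_localTime_eq {y : ℤ} {B : ℕ} (h : ∀ t, (mobState S x a t).2 y ≤ B) :
    ∃ T, ∀ t, T ≤ t → (mobState S x a t).2 y = totalDepartures S x a y := by
  have hbdd : BddAbove (Set.range fun t => (mobState S x a t).2 y) :=
    ⟨B, by rintro _ ⟨t, rfl⟩; exact h t⟩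
  obtain ⟨T, hT⟩ := Nat.sSup_mem (Set.range_nonempty _) hbdd
  have hc : ∀ t, T ≤ t → (mobState S x a t).2 y = (mobState S x a T).2 y := fun t ht =>
    le_antisymm ((le_csSup hbdd ⟨t, rfl⟩).trans hT.ge) (mobState_snd_mono y ht)
  exact ⟨T, fun t ht => (hc t ht).trans (totalDepartures_eq hc).symm⟩

/-- All the walkers of the mob walk with scheduling `S` go to `+∞`. -/
def MobTendsto (S : ℕ → Fin k) (x : Fin k → ℤ) (a : ArrowEnv) : Prop :=
  ∀ i, Tendsto (fun t => (mobState S x a t).1 i) atTop atTop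

theorem MobTendsto.eventually (h : MobTendsto S x a) (y : ℤ) :
    ∀ᶠ t in atTop, (∀ i, y < (mobState S x a t).1 i) ∧
      (mobState S x a t).2 y = totalDepartures S x a y := by
  have h1 : ∀ᶠ t in atTop, ∀ i, y < (mobState S x a t).1 i :=
    eventually_all.2 fun i => (h i).eventually_gt_atTop y
  obtain ⟨T, hT⟩ := eventually_atTop.1 h1
  have hc : ∀ t, T ≤ t → (mobState S x a t).2 y = (mobState S x a T).2 y := by
    intro t ht
    induction t, ht using Nat.le_induction with
    | base => rfl
    | succ t ht ih =>
      rw [mobState_succ_snd, if_neg (by have := hT t ht (S t); omega), ih]; rfl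
  filter_upwards [eventually_ge_atTop T] with t ht
  exact ⟨hT t ht, (hc t ht).trans (totalDepartures_eq hc).symm⟩

/-- This is the limit of `mobState_balance`: at a late time all `k` walkers are beyond `y` and the
local times at `y` and `y + 1` are final. -/
theorem MobTendsto.balance (h : MobTendsto S x a) (y : ℤ) :
    k + leftCount a (y + 1) (totalDepartures S x a (y + 1)) =
      (Finset.univ.filter fun i => y < x i).card + rightCount a y (totalDepartures S x a y) := by
  obtain ⟨t, h1, h2⟩ := ((h.eventually y).and (h.eventually (y + 1))).exists
  have hb := mobState_balance S x a t y
  rw [h1.2, h2.2, Finset.filter_true_of_mem fun i _ => h1.1 i] at hb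
  simpa using hb

theorem MobTendsto.rightCount_le (h : MobTendsto S x a) (y : ℤ) :
    rightCount a y (totalDepartures S x a y) ≤
      k + leftCount a (y + 1) (totalDepartures S x a (y + 1)) := by
  have := h.balance y
  omega

theorem MobTendsto.rightCount_eq (h : MobTendsto S x a) {y : ℤ} (hy : ∀ i, x i ≤ y) :
    k + leftCount a (y + 1) (totalDepartures S x a (y + 1)) =
      rightCount a y (totalDepartures S x a y) := by
  rw [h.balance y, Finset.filter_false_of_mem fun i _ => not_lt.2 (hy i)]
  simp

theorem MobTendsto.superSol (h : MobTendsto S x a) {m : ℤ} (hm : ∀ i, x i ≤ m) :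
    SuperSol k m a (totalDepartures S x a) := fun _ hy =>
  (h.rightCount_eq fun i => (hm i).trans hy).le

theorem SuperSol.totalDepartures_le {m : ℤ} {N : ℤ → ℕ} (h : SuperSol k m a N) {y : ℤ}
    (hy : m ≤ y) : totalDepartures S x a y ≤ N y := by
  obtain ⟨T, hT⟩ := exists_eventually_localTime_eq
    (fun t => h.localTime_le (S := S) (x := x) t hy)
  rw [← hT T le_rfl]
  exact h.localTime_le T hy

/-- Abelian property: to the right of both starting configurations each local time profile is a
supersolution, so each bounds the other. -/
theorem totalDepartures_congr {S' : ℕ → Fin k} {x' : Fin k → ℤ} (h : MobTendsto S x a)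
    (h' : MobTendsto S' x' a) {y : ℤ} (hy : ∀ i, x i ≤ y) (hy' : ∀ i, x' i ≤ y) :
    totalDepartures S x a y = totalDepartures S' x' a y :=
  le_antisymm ((h'.superSol hy').totalDepartures_le le_rfl)
    ((h.superSol hy).totalDepartures_le le_rfl)

end Mob

/-! ### Barriers -/

/-- Arbitrarily far to the left there are sites that a mob of `j` walkers never crosses to the
left. -/
def HasBarriers (j : ℕ) (a : ArrowEnv) : Prop :=
  ∀ w : ℤ, ∃ z ≤ w, ∃ N, SuperSol j z a N ∧ leftCount a z (N z) = 0

theorem HasBarriers.mono {j j' : ℕ} {a : ArrowEnv} (h : HasBarriers j a) (hj : j' ≤ j) :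
    HasBarriers j' a := fun w => by
  obtain ⟨z, hz, N, hN, h0⟩ := h w
  exact ⟨z, hz, N, hN.mono hj le_rfl, h0⟩

/-- Steps have size one, so descending below `z` requires a left arrow at `z`; but every departure
from `z` uses one of its first `N z` arrows, which all point right. -/
theorem SuperSol.le_mobState {k : ℕ} {S : ℕ → Fin k} {x : Fin k → ℤ} {a : ArrowEnv} {z : ℤ}
    {N : ℤ → ℕ} (hN : SuperSol k z a N) (h0 : leftCount a z (N z) = 0) {T : ℕ} {i : Fin k}
    (hx : z ≤ (mobState S x a T).1 i) {t : ℕ} (ht : T ≤ t) : z ≤ (mobState S x a t).1 i := by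
  induction t, ht using Nat.le_induction with
  | base => exact hx
  | succ t ht ih =>
    rw [mobState_succ_fst]
    split_ifs with hi
    · subst hi
      rcases ih.lt_or_eq with hlt | heq
      · have : -1 ≤ arrowStep (a ((mobState S x a t).1 (S t),
            (mobState S x a t).2 ((mobState S x a t).1 (S t)))) := by
          unfold arrowStep; split_ifs <;> omega
        omega
      · have hle := hN.localTime_le (S := S) (x := x) (t + 1) le_rfl
        rw [mobState_succ_snd, if_pos heq.symm] at hle
        rw [← heq, leftCount_eq_zero_iff.1 h0 _ hle]
        simp [arrowStep]
    · exact ih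

/-- Above a barrier left of all starting points the local times are bounded, so those on `[z, K]`
freeze. From then on whoever moves stands beyond `K`; each walker does move again, and afterwards
never drops below `K`. -/
theorem HasBarriers.mobRightTransient {k : ℕ} {a : ArrowEnv} (h : HasBarriers k a)
    (x : Fin k → ℤ) : MobRightTransient x a := by
  intro S hS i
  obtain ⟨w, hw⟩ : ∃ w, ∀ i, w ≤ x i := by
    obtain ⟨w, hw⟩ := (Set.finite_range x).bddBelow
    exact ⟨w, fun i => hw ⟨i, rfl⟩⟩
  obtain ⟨z, hz, N, hN, h0⟩ := h w
  have hpos : ∀ t i, z ≤ (mobState S x a t).1 i := fun t i =>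
    hN.le_mobState h0 (T := 0) (hz.trans (hw i)) (Nat.zero_le t)
  refine tendsto_atTop.2 fun K => ?_
  have hfin : ∀ y ∈ Finset.Icc z K, ∀ᶠ t in atTop,
      (mobState S x a t).2 y = totalDepartures S x a y := fun y hy => by
    obtain ⟨T, hT⟩ := exists_eventually_localTime_eq
      (fun t => hN.localTime_le (S := S) (x := x) t (Finset.mem_Icc.1 hy).1)
    exact eventually_atTop.2 ⟨T, hT⟩
  obtain ⟨T, hT⟩ := eventually_atTop.1 ((Filter.eventually_all_finset _).2 hfin)
  have hturn : ∀ t, T ≤ t → K < (mobState S x a t).1 (S t) := by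
    intro t ht
    by_contra hle
    have hmem : (mobState S x a t).1 (S t) ∈ Finset.Icc z K :=
      Finset.mem_Icc.2 ⟨hpos t _, not_lt.1 hle⟩
    have h1 := hT t ht _ hmem
    have h2 := hT (t + 1) (by omega) _ hmem
    rw [mobState_succ_snd, if_pos rfl] at h2
    omega
  obtain ⟨t₁, ht₁, hlt⟩ := (hS i).exists_gt T
  rw [Set.mem_ofPred_eq] at ht₁
  refine eventually_atTop.2 ⟨t₁, fun t ht => ?_⟩
  induction t, ht using Nat.le_induction with
  | base => have := hturn t₁ hlt.le; rw [ht₁] at this; exact this.le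
  | succ t ht ih =>
    rw [mobState_succ_fst]
    split_ifs with hi
    · have := hturn t (hlt.le.trans ht)
      have : -1 ≤ arrowStep (a ((mobState S x a t).1 (S t),
          (mobState S x a t).2 ((mobState S x a t).1 (S t)))) := by
        unfold arrowStep; split_ifs <;> omega
      omega
    · exact ih

/-! ### Leftover environments -/

section Leftover

variable {k : ℕ} {S : ℕ → Fin k} {x : Fin k → ℤ} {a : ArrowEnv}

theorem rightCount_leftover (y : ℤ) (n : ℕ) :
    rightCount a y (totalDepartures S x a y + n) =
      rightCount a y (totalDepartures S x a y) + rightCount (leftover S x a) y n := by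
  simp only [rightCount, leftover, Nat.count_add, totalDepartures,
    add_comm _ (mobLocalTime S x a y).toNat]

theorem leftCount_leftover (y : ℤ) (n : ℕ) :
    leftCount a y (totalDepartures S x a y + n) =
      leftCount a y (totalDepartures S x a y) + leftCount (leftover S x a) y n := by
  simp only [leftCount, leftover, Nat.count_add, totalDepartures,
    add_comm _ (mobLocalTime S x a y).toNat]

/-- Subtract the balance of the `k`-mob from the inequality of order `k + 1`. Only the upper bound
`MobTendsto.rightCount_le` is needed, and it holds at every site, so `m` need not lie to the right
of the starting points. -/
theorem SuperSol.leftover {m : ℤ} {N : ℤ → ℕ} (h : SuperSol (k + 1) m a N)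
    (ht : MobTendsto S x a) :
    SuperSol 1 m (leftover S x a) fun y => N y - totalDepartures S x a y := by
  intro y hy
  have hle : ∀ y, m ≤ y → totalDepartures S x a y ≤ N y := fun y hy =>
    (h.mono k.le_succ le_rfl).totalDepartures_le hy
  have h1 := rightCount_leftover (S := S) (x := x) (a := a) y (N y - totalDepartures S x a y)
  have h2 := leftCount_leftover (S := S) (x := x) (a := a) (y + 1)
    (N (y + 1) - totalDepartures S x a (y + 1))
  rw [Nat.add_sub_cancel' (hle y hy)] at h1
  rw [Nat.add_sub_cancel' (hle (y + 1) (by omega))] at h2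
  have h3 := h y hy
  have h4 := ht.rightCount_le y
  dsimp only
  omega

theorem leftCount_leftover_eq_zero {z : ℤ} {n : ℕ} (hn : totalDepartures S x a z ≤ n)
    (h0 : leftCount a z n = 0) :
    leftCount (_root_.leftover S x a) z (n - totalDepartures S x a z) = 0 := by
  have h1 := leftCount_leftover (S := S) (x := x) (a := a) z (n - totalDepartures S x a z)
  rw [Nat.add_sub_cancel' hn] at h1
  omega

theorem HasBarriers.mobTendsto (h : HasBarriers k a) (hS : ProperScheduling S) (x : Fin k → ℤ) :
    MobTendsto S x a := fun i => h.mobRightTransient x S hS i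

theorem HasBarriers.leftover (h : HasBarriers (k + 1) a) (hS : ProperScheduling S)
    (x : Fin k → ℤ) : HasBarriers 1 (leftover S x a) := fun w => by
  obtain ⟨z, hz, N, hN, h0⟩ := h w
  exact ⟨z, hz, _, hN.leftover ((h.mono k.le_succ).mobTendsto hS x),
    leftCount_leftover_eq_zero ((hN.mono k.le_succ le_rfl).totalDepartures_le le_rfl) h0⟩

/-- To the right of the initial positions, the leftover environment is the limit one. -/
theorem leftover_eq_limitLeftover (h : MobTendsto S x a) {y : ℤ}
    (h' : MobTendsto S (fun _ => y) a) (hy : ∀ i, x i ≤ y) (i : ℕ) :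
    leftover S x a (y, i) = limitLeftover S a (y, i) := by
  have := totalDepartures_congr h h' hy (fun _ => le_rfl)
  simp only [totalDepartures] at this
  simp only [limitLeftover, leftover, this]

/-- With all walkers started at the barrier `z`, the ordinary and the limit leftover agree on `[z,
∞)`, which is all that a barrier at `z` involves. -/
theorem HasBarriers.limitLeftover (h : HasBarriers (k + 1) a) (hS : ProperScheduling S) :
    HasBarriers 1 (limitLeftover S a) := fun w => by
  obtain ⟨z, hz, N, hN, h0⟩ := h w
  have ht := (h.mono k.le_succ).mobTendsto hS
  have hc : ∀ y, z ≤ y → ∀ i,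
      _root_.leftover S (fun _ => z) a (y, i) = _root_.limitLeftover S a (y, i) :=
    fun y hy => leftover_eq_limitLeftover (ht _) (ht _) fun _ => hy
  refine ⟨z, hz, _, (hN.leftover (ht fun _ => z)).congr hc, ?_⟩
  rw [← leftCount_congr (hc z le_rfl)]
  exact leftCount_leftover_eq_zero ((hN.mono k.le_succ le_rfl).totalDepartures_le le_rfl) h0

theorem walk_mobTendsto_iff {c : ArrowEnv} :
    MobTendsto (fun _ => (0 : Fin 1)) (fun _ => 0) c ↔ WalkRightTransient c := by
  simp only [MobTendsto, WalkRightTransient, Fin.forall_fin_one]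
  exact Iff.rfl

theorem properScheduling_fin_one : ProperScheduling (fun _ => (0 : Fin 1)) := fun i => by
  simpa [Subsingleton.elim _ i] using Set.infinite_univ (α := ℕ)

theorem HasBarriers.walkRightTransient {c : ArrowEnv} (h : HasBarriers 1 c) :
    WalkRightTransient c :=
  walk_mobTendsto_iff.1 (h.mobTendsto properScheduling_fin_one _)

/-- The total number of departures from `y` of the walk started from `0`. -/
noncomputable def walkDepartures (c : ArrowEnv) : ℤ → ℕ :=
  totalDepartures (fun _ => (0 : Fin 1)) (fun _ => 0) c

/-- Converse of `SuperSol.leftover`: the balance of the mob and that of one walker on its leftover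
add up. Agreement with `c` on `[m, ∞)` suffices, so that `c` may be the leftover or the limit
leftover. -/
theorem superSol_add_walkDepartures (h : MobTendsto S x a) {c : ArrowEnv}
    (hc : WalkRightTransient c) {m : ℤ} (hm : ∀ i, x i ≤ m) (hm0 : 0 ≤ m)
    (hac : ∀ y, m ≤ y → ∀ i, leftover S x a (y, i) = c (y, i)) :
    SuperSol (k + 1) m a fun y => totalDepartures S x a y + walkDepartures c y := by
  intro y hy
  simp only [rightCount_leftover, leftCount_leftover]
  rw [rightCount_congr (hac y hy), leftCount_congr (hac (y + 1) (by omega))]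
  have h1 := h.superSol hm y hy
  have h2 := (walk_mobTendsto_iff.2 hc).superSol (m := m) (fun _ => hm0) y hy
  simp only [walkDepartures]
  omega

end Leftover

/-! ### Shifts of the annealed law -/

/-- The translation of cookie environments by `z`. -/
def cookieTranslate (z : ℤ) (ω : CookieEnv) : CookieEnv := fun p => ω (p.1 + z, p.2)

/-- The translation of arrow environments by `z`. -/
def arrowTranslate (z : ℤ) (a : ArrowEnv) : ArrowEnv := fun p => a (p.1 + z, p.2)

theorem measurable_arrowTranslate (z : ℤ) : Measurable (arrowTranslate z) :=
  measurable_pi_lambda _ fun _ => measurable_pi_apply _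

theorem measurable_cookieTranslate (z : ℤ) : Measurable (cookieTranslate z) :=
  measurable_pi_lambda _ fun _ => measurable_pi_apply _

theorem arrowTranslate_add (z w : ℤ) (a : ArrowEnv) :
    arrowTranslate z (arrowTranslate w a) = arrowTranslate (z + w) a := by
  funext p; simp [arrowTranslate, add_assoc]

theorem cookieTranslate_comp (z w : ℤ) :
    cookieTranslate z ∘ cookieTranslate w = cookieTranslate (z + w) := by
  funext ω p; simp [cookieTranslate, add_assoc]

theorem cookieTranslate_zero : cookieTranslate 0 = id := by
  funext ω p; simp [cookieTranslate]

theorem arrowTranslate_zero (a : ArrowEnv) : arrowTranslate 0 a = a := by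
  funext p; simp [arrowTranslate]

theorem map_arrowTranslate_quenchedArrowLaw (z : ℤ) (ω : CookieEnv) :
    (quenchedArrowLaw ω).map (arrowTranslate z) = quenchedArrowLaw (cookieTranslate z ω) :=
  Measure.map_infinitePi_infinitePi_of_inj (Ω := fun _ => Bool)
    (P := fun p => bernoulliMeasure true false (ω p))
    (f := fun p : ℤ × ℕ => (p.1 + z, p.2)) fun p q h => by
      simp only [Prod.mk.injEq, add_left_inj] at h
      exact Prod.ext h.1 h.2

variable {P : Measure CookieEnv}

theorem StationaryErgodic.measurePreserving (hP : StationaryErgodic P) (z : ℤ) :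
    MeasurePreserving (cookieTranslate z) P P := by
  have h1 : MeasurePreserving (cookieTranslate 1) P P := hP.toMeasurePreserving
  have hneg : MeasurePreserving (cookieTranslate (-1)) P P := by
    refine ⟨measurable_cookieTranslate _, ?_⟩
    conv_lhs => rw [← h1.map_eq]
    rw [Measure.map_map (measurable_cookieTranslate _) (measurable_cookieTranslate _),
      cookieTranslate_comp]
    simp [cookieTranslate_zero]
  induction z using Int.induction_on with
  | zero => rw [cookieTranslate_zero]; exact MeasurePreserving.id P
  | succ n ih => rw [← cookieTranslate_comp]; exact ih.comp h1
  | pred n ih => rw [sub_eq_add_neg, ← cookieTranslate_comp]; exact ih.comp hneg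

theorem annealedArrowLaw_apply {s : Set ArrowEnv} (hs : MeasurableSet s) :
    annealedArrowLaw P s = ∫⁻ ω, quenchedArrowLaw ω s ∂P :=
  Measure.bind_apply hs measurable_quenchedArrowLaw.aemeasurable

instance [IsProbabilityMeasure P] : IsProbabilityMeasure (annealedArrowLaw P) :=
  ⟨by simp [annealedArrowLaw_apply MeasurableSet.univ]⟩

theorem StationaryErgodic.measurePreserving_arrowTranslate (hP : StationaryErgodic P) (z : ℤ) :
    MeasurePreserving (arrowTranslate z) (annealedArrowLaw P) (annealedArrowLaw P) := by
  refine ⟨measurable_arrowTranslate z, Measure.ext fun s hs => ?_⟩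
  rw [Measure.map_apply (measurable_arrowTranslate z) hs,
    annealedArrowLaw_apply (measurable_arrowTranslate z hs), annealedArrowLaw_apply hs]
  simp_rw [← Measure.map_apply (measurable_arrowTranslate z) hs,
    map_arrowTranslate_quenchedArrowLaw]
  exact (hP.measurePreserving z).lintegral_comp
    (Measure.measurable_measure.1 measurable_quenchedArrowLaw s hs)

/-! ### Ergodicity of the annealed law -/

theorem exists_translate_disjoint (s : Finset (ℤ × ℕ)) :
    ∃ z : ℤ, Disjoint s (s.image fun p => (p.1 + z, p.2)) := by
  obtain ⟨B, hB⟩ := (s.image fun p => |p.1|).bddAbove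
  refine ⟨2 * B + 1, Finset.disjoint_left.2 fun p hp hq => ?_⟩
  obtain ⟨q, hq', rfl⟩ := Finset.mem_image.1 hq
  have h1 := abs_le.1 (hB (Finset.mem_coe.2 (Finset.mem_image_of_mem (fun p : ℤ × ℕ => |p.1|) hp)))
  have h2 := abs_le.1 (hB (Finset.mem_coe.2 (Finset.mem_image_of_mem (fun p : ℤ × ℕ => |p.1|) hq')))
  dsimp only at h1 h2
  omega

/-- Given the cookies, arrows at disjoint sets of indices are independent; this quenched
independence substitutes for mixing in the ergodicity proof. -/
theorem quenchedArrowLaw_inter_translate (ω : CookieEnv) {s : Finset (ℤ × ℕ)} {z : ℤ}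
    (hs : Disjoint s (s.image fun p => (p.1 + z, p.2))) {C : Set (s → Bool)}
    (hC : MeasurableSet C) :
    quenchedArrowLaw ω (s.restrict ⁻¹' C ∩ arrowTranslate z ⁻¹' (s.restrict ⁻¹' C)) =
      quenchedArrowLaw ω (s.restrict ⁻¹' C) *
        quenchedArrowLaw ω (arrowTranslate z ⁻¹' (s.restrict ⁻¹' C)) := by
  have hi : iIndepFun (fun (p : ℤ × ℕ) (a : ArrowEnv) => a p) (quenchedArrowLaw ω) :=
    iIndepFun_infinitePi (X := fun _ v => v) fun _ => measurable_id
  have h2 := hi.indepFun_finset s _ hs fun p => measurable_pi_apply p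
  let φ : ((s.image fun p : ℤ × ℕ => (p.1 + z, p.2) : Finset (ℤ × ℕ)) → Bool) → s → Bool :=
    fun g i => g ⟨(i.1.1 + z, i.1.2), Finset.mem_image_of_mem _ i.2⟩
  have hφ : Measurable φ := measurable_pi_lambda _ fun _ => measurable_pi_apply _
  exact h2.measure_inter_preimage_eq_mul _ _ hC (hφ hC)

/-- If two independent events are both close to `A`, then `A` is nearly independent of itself. -/
theorem abs_sub_sq_le_of_inter_eq_mul {α : Type*} [MeasurableSpace α] {Q : Measure α}
    [IsProbabilityMeasure Q] {A C C' : Set α} (hA : MeasurableSet A) (hC : MeasurableSet C)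
    (hC' : MeasurableSet C') (h : Q (C ∩ C') = Q C * Q C') :
    |Q.real A - Q.real A ^ 2| ≤ 2 * (Q.real (symmDiff C A) + Q.real (symmDiff C' A)) := by
  have h1 := abs_measureReal_sub_le_measureReal_symmDiff (μ := Q) hC.nullMeasurableSet hA.nullMeasurableSet
  have h2 := abs_measureReal_sub_le_measureReal_symmDiff (μ := Q) hC'.nullMeasurableSet hA.nullMeasurableSet
  have h3 := abs_measureReal_sub_le_measureReal_symmDiff (μ := Q) (hC.inter hC').nullMeasurableSet hA.nullMeasurableSet
  have h4 : Q.real (symmDiff (C ∩ C') A) ≤ Q.real (symmDiff C A) + Q.real (symmDiff C' A) := by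
    refine (measureReal_mono ?_).trans (measureReal_union_le _ _)
    intro x
    simp only [Set.mem_symmDiff, Set.mem_union, Set.mem_inter_iff]
    tauto
  have h5 : Q.real (C ∩ C') = Q.real C * Q.real C' := by
    simp [measureReal_def, h, ENNReal.toReal_mul]
  rw [h5] at h3
  have a0 : 0 ≤ Q.real A := measureReal_nonneg
  have a1 : Q.real A ≤ 1 := measureReal_le_one
  have c0 : 0 ≤ Q.real C := measureReal_nonneg
  have c1 : Q.real C ≤ 1 := measureReal_le_one
  have h6 : |Q.real C * Q.real C' - Q.real A ^ 2| ≤ |Q.real C - Q.real A| +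
      |Q.real C' - Q.real A| := by
    have : Q.real C * Q.real C' - Q.real A ^ 2 =
        Q.real A * (Q.real C - Q.real A) + Q.real C * (Q.real C' - Q.real A) := by ring
    rw [this]
    refine (abs_add_le _ _).trans ?_
    rw [abs_mul, abs_mul, abs_of_nonneg a0, abs_of_nonneg c0]
    exact add_le_add (mul_le_of_le_one_left (abs_nonneg _) a1)
      (mul_le_of_le_one_left (abs_nonneg _) c1)
  have h7 : |Q.real A - Q.real A ^ 2| ≤ |Q.real C * Q.real C' - Q.real A| +
      |Q.real C * Q.real C' - Q.real A ^ 2| := by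
    rw [abs_sub_comm (Q.real C * Q.real C') (Q.real A)]
    exact abs_sub_le _ _ _
  linarith

/-- The quenched probability of an invariant event `A` is a shift-invariant function of the cookies,
hence almost surely a constant `c`. Approximating `A` by a cylinder and by a far translate of it,
which are quenched independent, gives `c = c ^ 2`. -/
theorem StationaryErgodic.ergodic_arrowTranslate [IsProbabilityMeasure P]
    (hP : StationaryErgodic P) : Ergodic (arrowTranslate 1) (annealedArrowLaw P) := by
  refine { hP.measurePreserving_arrowTranslate 1 with aeconst_set := fun A hA hinv => ?_ }
  have hQm : ∀ {s}, MeasurableSet s → Measurable fun ω => quenchedArrowLaw ω s := fun hs =>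
    Measure.measurable_measure.1 measurable_quenchedArrowLaw _ hs
  have hinvz : ∀ z : ℤ, arrowTranslate z ⁻¹' A = A := by
    have h1 : ∀ a, arrowTranslate 1 a ∈ A ↔ a ∈ A := fun a => by
      conv_rhs => rw [← hinv]
      exact Iff.rfl
    intro z
    ext a
    change arrowTranslate z a ∈ A ↔ a ∈ A
    induction z using Int.induction_on with
    | zero => rw [arrowTranslate_zero]
    | succ n ih => rw [add_comm, ← arrowTranslate_add, h1, ih]
    | pred n ih => rw [← h1, arrowTranslate_add, add_sub_cancel, ih]
  obtain ⟨c, hc⟩ := hP.toPreErgodic.ae_eq_const_of_ae_eq_comp (hQm hA) (funext fun ω => by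
    change quenchedArrowLaw (cookieTranslate 1 ω) A = _
    rw [← map_arrowTranslate_quenchedArrowLaw, Measure.map_apply (measurable_arrowTranslate 1) hA,
      hinv])
  have hμA : annealedArrowLaw P A = c := by
    rw [annealedArrowLaw_apply hA, lintegral_congr_ae hc]
    simp
  have hctop : c ≠ ⊤ := hμA ▸ measure_ne_top _ _
  have key : ∀ ε : ENNReal, 0 < ε → ENNReal.ofReal |c.toReal - c.toReal ^ 2| ≤ 4 * ε := by
    intro ε hε
    obtain ⟨C, hC, hCA⟩ := exists_measure_symmDiff_lt_of_generateFrom_isSetRing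
      (μ := annealedArrowLaw P) (C := measurableCylinders fun _ : ℤ × ℕ => Bool)
      isSetRing_measurableCylinders ⟨{Set.univ}, Set.countable_singleton _,
        by simpa using univ_mem_measurableCylinders (fun _ : ℤ × ℕ => Bool), by simp⟩
      generateFrom_measurableCylinders.symm hA hε
    obtain ⟨s, D, hD, rfl⟩ := (mem_measurableCylinders _).1 hC
    obtain ⟨z, hz⟩ := exists_translate_disjoint s
    have hCm : MeasurableSet (cylinder (α := fun _ : ℤ × ℕ => Bool) s D) := MeasurableSet.cylinder s hD
    have hC'm := measurable_arrowTranslate z hCm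
    have hsym : arrowTranslate z ⁻¹' symmDiff (cylinder s D) A =
        symmDiff (arrowTranslate z ⁻¹' cylinder s D) A := by
      conv_rhs => rw [← hinvz z]
      rfl
    have hle : ∀ᵐ ω ∂P, ENNReal.ofReal |c.toReal - c.toReal ^ 2| ≤
        2 * (quenchedArrowLaw ω (symmDiff (cylinder s D) A) +
          quenchedArrowLaw ω (arrowTranslate z ⁻¹' symmDiff (cylinder s D) A)) := by
      filter_upwards [hc] with ω hω
      have h1 := abs_sub_sq_le_of_inter_eq_mul hA hCm hC'm
        (quenchedArrowLaw_inter_translate ω hz hD)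
      have h2 : (quenchedArrowLaw ω).real A = c.toReal := congrArg ENNReal.toReal hω
      rw [h2, ← hsym] at h1
      refine (ENNReal.ofReal_le_ofReal h1).trans ?_
      rw [ENNReal.ofReal_mul zero_le_two, ENNReal.ofReal_add measureReal_nonneg measureReal_nonneg,
        ofReal_measureReal, ofReal_measureReal]
      simp
    have hm := hCm.symmDiff hA
    -- Integrating over the cookies makes both errors annealed, and by stationarity the translated
    -- one has the same size as the other.
    have h3 := lintegral_mono_ae hle
    rw [lintegral_const, measure_univ, mul_one, lintegral_const_mul' _ _ ENNReal.ofNat_ne_top,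
      lintegral_add_left (hQm hm),
      ← annealedArrowLaw_apply hm, ← annealedArrowLaw_apply (measurable_arrowTranslate z hm),
      (hP.measurePreserving_arrowTranslate z).measure_preimage hm.nullMeasurableSet] at h3
    refine h3.trans ?_
    calc 2 * (annealedArrowLaw P (symmDiff (cylinder s D) A) +
        annealedArrowLaw P (symmDiff (cylinder s D) A)) ≤ 2 * (ε + ε) := by gcongr
      _ = 4 * ε := by ring
  have hzero : |c.toReal - c.toReal ^ 2| = 0 := by
    refine le_antisymm (le_of_forall_pos_le_add fun ε hε => ?_) (abs_nonneg _)
    have h := key (ENNReal.ofReal (ε / 4)) (ENNReal.ofReal_pos.2 (by positivity))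
    rw [← ENNReal.ofReal_ofNat 4, ← ENNReal.ofReal_mul (by norm_num),
      ENNReal.ofReal_le_ofReal_iff (by positivity)] at h
    linarith
  have h01 : c.toReal * (1 - c.toReal) = 0 := by
    have := abs_eq_zero.1 hzero
    linarith
  rw [eventuallyConst_set']
  rcases mul_eq_zero.1 h01 with h | h
  · left
    rw [ae_eq_empty, hμA]
    exact ((ENNReal.toReal_eq_zero_iff _).1 h).resolve_right hctop
  · right
    rw [ae_eq_univ, prob_compl_eq_zero_iff hA, hμA, ← ENNReal.ofReal_toReal hctop,
      ← sub_eq_zero.1 h, ENNReal.ofReal_one]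

/-! ### Resampling finitely many arrows -/

theorem measurable_update_pair (p : ℤ × ℕ) :
    Measurable fun q : Bool × ArrowEnv => Function.update q.2 p q.1 := by
  refine measurable_pi_lambda _ fun r => ?_
  by_cases h : r = p
  · subst h; simpa using measurable_fst
  · simp only [Function.update_of_ne h]
    exact (measurable_pi_apply r).comp measurable_snd

/-- Resampling one arrow independently leaves the quenched law unchanged, so a single arrow can be
prescribed at the cost of one positive factor. -/
theorem map_update_quenchedArrowLaw (ω : CookieEnv) (p : ℤ × ℕ) :
    ((bernoulliMeasure true false (ω p)).prod (quenchedArrowLaw ω)).map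
      (fun q : Bool × ArrowEnv => Function.update q.2 p q.1) = quenchedArrowLaw ω := by
  refine Measure.eq_infinitePi _ fun s t ht => ?_
  rw [Measure.map_apply (measurable_update_pair p) (MeasurableSet.pi s.countable_toSet fun i _ => ht i)]
  by_cases hp : p ∈ s
  · have : (fun q : Bool × ArrowEnv => Function.update q.2 p q.1) ⁻¹' (s : Set (ℤ × ℕ)).pi t
        = t p ×ˢ ((s.erase p : Finset (ℤ × ℕ)) : Set (ℤ × ℕ)).pi t := by
      ext ⟨v, a⟩
      simp only [Set.mem_preimage, Set.mem_pi, Finset.mem_coe, Set.mem_prod, Finset.mem_erase]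
      constructor
      · intro h
        exact ⟨by simpa using h p hp, fun r hr => by simpa [hr.1] using h r hr.2⟩
      · rintro ⟨h1, h2⟩ r hr
        by_cases hrp : r = p
        · subst hrp; simpa using h1
        · simpa [hrp] using h2 r ⟨hrp, hr⟩
    rw [this, Measure.prod_prod, quenchedArrowLaw, Measure.infinitePi_pi _ fun i _ => ht i,
      Finset.mul_prod_erase s (fun r => bernoulliMeasure true false (ω r) (t r)) hp]
  · have : (fun q : Bool × ArrowEnv => Function.update q.2 p q.1) ⁻¹' (s : Set (ℤ × ℕ)).pi t
        = Set.univ ×ˢ (s : Set (ℤ × ℕ)).pi t := by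
      ext ⟨v, a⟩
      simp only [Set.mem_preimage, Set.mem_pi, Finset.mem_coe, Set.mem_prod, Set.mem_univ, true_and]
      refine forall₂_congr fun r hr => ?_
      have : r ≠ p := fun h => hp (h ▸ hr)
      simp [this]
    rw [this, Measure.prod_prod, quenchedArrowLaw, Measure.infinitePi_pi _ fun i _ => ht i,
      measure_univ, one_mul]

theorem measurable_update_const (p : ℤ × ℕ) (v : Bool) :
    Measurable fun a : ArrowEnv => Function.update a p v := by
  refine measurable_pi_lambda _ fun r => ?_
  by_cases h : r = p
  · subst h; simp
  · simpa [h] using measurable_pi_apply r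

theorem measurableSet_exists_update {C : Set ArrowEnv} (hC : MeasurableSet C) (p : ℤ × ℕ) :
    MeasurableSet {a : ArrowEnv | ∃ v, Function.update a p v ∈ C} := by
  simp only [Set.ofPred_exists]
  exact MeasurableSet.iUnion fun v => measurable_update_const _ v hC

/-- The environments with `n` right arrows at the bottom of the stack at `m`, obtained from an
environment in `C` by changing these arrows. -/
def forceRight (C : Set ArrowEnv) (m : ℤ) : ℕ → Set ArrowEnv
  | 0 => C
  | n + 1 => {a | a (m, n) = true ∧ ∃ v, Function.update a (m, n) v ∈ forceRight C m n}

theorem measurableSet_forceRight {C : Set ArrowEnv} (hC : MeasurableSet C) (m : ℤ) (n : ℕ) :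
    MeasurableSet (forceRight C m n) := by
  induction n with
  | zero => exact hC
  | succ n ih =>
    exact (measurableSet_eq_fun (measurable_pi_apply (m, n)) measurable_const).inter
      (measurableSet_exists_update ih _)

theorem exists_of_mem_forceRight {C : Set ArrowEnv} {m : ℤ} {n : ℕ} {a : ArrowEnv}
    (ha : a ∈ forceRight C m n) :
    (∀ i < n, a (m, i) = true) ∧ ∃ b ∈ C, ∀ y ≠ m, ∀ i, b (y, i) = a (y, i) := by
  induction n generalizing a with
  | zero => exact ⟨by simp, a, ha, fun _ _ _ => rfl⟩
  | succ n ih =>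
    obtain ⟨h1, v, hv⟩ := ha
    obtain ⟨h2, b, hb, hba⟩ := ih hv
    refine ⟨fun i hi => ?_, b, hb, fun y hy i => ?_⟩
    · rcases Nat.lt_succ_iff_lt_or_eq.1 hi with h | rfl
      · simpa [h.ne] using h2 i h
      · exact h1
    · simpa [hy] using hba y hy i

theorem quenchedArrowLaw_forceRight_pos {ω : CookieEnv} {C : Set ArrowEnv} (hC : MeasurableSet C)
    (hpos : 0 < quenchedArrowLaw ω C) {m : ℤ} (hω : ∀ n, 0 < ω (m, n)) (n : ℕ) :
    0 < quenchedArrowLaw ω (forceRight C m n) := by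
  induction n with
  | zero => exact hpos
  | succ n ih =>
    have hsub : forceRight C m n ⊆ {a | ∃ v, Function.update a (m, n) v ∈ forceRight C m n} :=
      fun a ha => ⟨a (m, n), by simpa using ha⟩
    rw [← map_update_quenchedArrowLaw ω (m, n),
      Measure.map_apply (measurable_update_pair _) (measurableSet_forceRight hC m (n + 1))]
    have heq : (fun q : Bool × ArrowEnv => Function.update q.2 (m, n) q.1) ⁻¹'
        forceRight C m (n + 1) =
        {true} ×ˢ {a | ∃ v, Function.update a (m, n) v ∈ forceRight C m n} := by
      ext ⟨v, a⟩
      simp [forceRight]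
    rw [heq, Measure.prod_prod]
    refine ENNReal.mul_pos ?_ (ih.trans_le (measure_mono hsub)).ne'
    classical
    rw [bernoulliMeasure_apply _ (measurableSet_singleton true)]
    simpa [← NNReal.coe_eq_zero] using (hω n).ne'

/-! ### Barriers exist almost surely -/

theorem SuperSol.of_arrowTranslate {j : ℕ} {m z : ℤ} {a : ArrowEnv} {N : ℤ → ℕ}
    (h : SuperSol j m (arrowTranslate z a) N) : SuperSol j (m + z) a fun y => N (y - z) := by
  intro y hy
  have h1 := h (y - z) (by omega)
  have h2 : y - z + 1 + z = y + 1 := by ring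
  simpa [leftCount, rightCount, arrowTranslate, add_sub_right_comm, h2] using h1

theorem ae_quenched_of_ae_annealed {p : ArrowEnv → Prop}
    (h : ∀ᵐ a ∂annealedArrowLaw P, p a) : ∀ᵐ ω ∂P, ∀ᵐ a ∂quenchedArrowLaw ω, p a :=
  Measure.ae_ae_of_ae_bind measurable_quenchedArrowLaw.aemeasurable h

/-- A set of positive annealed measure is visited infinitely often by the shifts to the left. -/
theorem StationaryErgodic.ae_exists_arrowTranslate_mem [IsProbabilityMeasure P]
    (hP : StationaryErgodic P) {B : Set ArrowEnv} (hB : MeasurableSet B)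
    (hpos : 0 < annealedArrowLaw P B) :
    ∀ᵐ a ∂annealedArrowLaw P, ∀ w : ℤ, ∃ z ≤ w, arrowTranslate z a ∈ B := by
  set μ := annealedArrowLaw P
  -- `E n` says that no translate at or left of `-n` falls in `B`. The union over `n` is
  -- shift-invariant and has measure at most `1 - μ B`, so by ergodicity it is null.
  let E : ℕ → Set ArrowEnv := fun n => {a | ∀ z : ℤ, z ≤ -n → arrowTranslate z a ∉ B}
  have hEm : ∀ n, MeasurableSet (E n) := fun n => by
    simp only [E, Set.ofPred_forall]
    exact MeasurableSet.iInter fun z => MeasurableSet.iInter fun _ =>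
      (measurable_arrowTranslate z hB).compl
  have hEmono : Monotone E := fun n n' hn a ha z hz => ha z (by omega)
  have hinv : arrowTranslate 1 ⁻¹' (⋃ n, E n) = ⋃ n, E n := by
    ext a
    simp only [Set.mem_preimage, Set.mem_iUnion, E, Set.mem_ofPred_eq, arrowTranslate_add]
    constructor
    · rintro ⟨n, hn⟩
      exact ⟨n, fun z hz => by simpa using hn (z - 1) (by omega)⟩
    · rintro ⟨n, hn⟩
      exact ⟨n + 1, fun z hz => hn (z + 1) (by push_cast at hz; omega)⟩
  have hle : μ (⋃ n, E n) ≤ 1 - μ B := by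
    rw [hEmono.measure_iUnion]
    refine iSup_le fun n => ?_
    calc μ (E n) ≤ μ (arrowTranslate (-n) ⁻¹' Bᶜ) := measure_mono fun a ha => ha _ le_rfl
      _ = 1 - μ B := by
        rw [(hP.measurePreserving_arrowTranslate _).measure_preimage hB.compl.nullMeasurableSet,
          prob_compl_eq_one_sub hB]
  have h0 : μ (⋃ n, E n) = 0 := by
    refine (hP.ergodic_arrowTranslate.prob_eq_zero_or_one
      (MeasurableSet.iUnion hEm) hinv).resolve_right fun h1 => ?_
    rw [h1] at hle
    exact absurd hle (not_le.2 (ENNReal.sub_lt_self ENNReal.one_ne_top one_ne_zero hpos.ne'))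
  filter_upwards [measure_eq_zero_iff_ae_notMem.1 h0] with a ha w
  by_contra! hcon
  exact ha (Set.mem_iUnion.2 ⟨w.natAbs, fun z hz => hcon z (by omega)⟩)

/-- A profile on `[m + 1, ∞)` ignores the arrows at `m`. Turning enough of the bottom arrows at `m`
to the right extends it to a barrier at `m`; this event has positive probability and therefore
recurs arbitrarily far to the left. -/
theorem StationaryErgodic.ae_hasBarriers [IsProbabilityMeasure P] (hP : StationaryErgodic P)
    (hWEL : WeaklyElliptic P) {j : ℕ} {m : ℤ} {N : ArrowEnv → ℤ → ℕ}
    (hNm : Measurable fun a => N a (m + 1))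
    (hN : ∀ᵐ a ∂annealedArrowLaw P, SuperSol j (m + 1) a (N a)) :
    ∀ᵐ a ∂annealedArrowLaw P, HasBarriers j a := by
  -- The set of good environments is replaced by a measurable subset of full measure, as its own
  -- measurability is not available.
  obtain ⟨A, hA, hAm, hA1⟩ : ∃ A ⊆ {a | SuperSol j (m + 1) a (N a)}, MeasurableSet A ∧
      annealedArrowLaw P Aᶜ = 0 := by
    obtain ⟨A, h1, h2, h3⟩ := exists_measurable_superset_of_null (ae_iff.1 hN)
    exact ⟨Aᶜ, Set.compl_subset_comm.1 h1, h2.compl, by rwa [compl_compl]⟩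
  let C : ℕ → Set ArrowEnv := fun n => A ∩ {a | N a (m + 1) ≤ n}
  have hCm : ∀ n, MeasurableSet (C n) := fun n => hAm.inter (hNm measurableSet_Iic)
  let B : Set ArrowEnv := ⋃ n, forceRight (C n) m (j + n)
  have hBm : MeasurableSet B :=
    MeasurableSet.iUnion fun n => measurableSet_forceRight (hCm n) m _
  have hBbar : ∀ a ∈ B, ∃ N', SuperSol j m a N' ∧ leftCount a m (N' m) = 0 := by
    intro a ha
    obtain ⟨n, hn⟩ := Set.mem_iUnion.1 ha
    obtain ⟨h1, b, hb, hba⟩ := exists_of_mem_forceRight hn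
    have hs : SuperSol j (m + 1) a (N b) := SuperSol.congr (hA hb.1)
      fun y hy i => hba y (by omega) i
    have h0 : leftCount a m (j + n) = 0 := leftCount_eq_zero_iff.2 h1
    -- Why `j + n` right arrows suffice: `j` for the walkers, and `n` to outweigh the left arrows
    -- from `m + 1`, of which there are at most `N b (m + 1) ≤ n`.
    refine ⟨Function.update (N b) m (j + n), fun y hy => ?_, by simpa using h0⟩
    rcases hy.lt_or_eq with hlt | rfl
    · have h2 : y ≠ m := by omega
      have h3 : y + 1 ≠ m := by omega
      simpa [h2, h3] using hs y hlt
    · have h3 : m + 1 ≠ m := by omega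
      have h4 := rightCount_add_leftCount a m (j + n)
      have h5 := rightCount_add_leftCount a (m + 1) (N b (m + 1))
      have h6 : N b (m + 1) ≤ n := hb.2
      simp only [Function.update_self, Function.update_of_ne h3]
      omega
  have hBpos : 0 < annealedArrowLaw P B := by
    rw [pos_iff_ne_zero]
    intro h0
    rw [annealedArrowLaw_apply hBm, lintegral_eq_zero_iff
      (Measure.measurable_measure.1 measurable_quenchedArrowLaw _ hBm)] at h0
    refine (hWEL m).1.ne' (measure_mono_null (fun ω hω => ?_)
      (ae_iff.1 (h0.and (ae_quenched_of_ae_annealed (measure_eq_zero_iff_ae_notMem.1 hA1)))))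
    rintro ⟨hB0, hA1ω⟩
    have hunion : quenchedArrowLaw ω (⋃ n, C n) ≠ 0 := by
      intro hz
      obtain ⟨a, ha, ha'⟩ := (hA1ω.and (measure_eq_zero_iff_ae_notMem.1 hz)).exists
      exact ha' (Set.mem_iUnion.2 ⟨N a (m + 1), not_not.1 ha, le_refl (N a (m + 1))⟩)
    obtain ⟨n, hn⟩ := exists_measure_pos_of_not_measure_iUnion_null hunion
    exact ((quenchedArrowLaw_forceRight_pos (hCm n) hn hω (j + n)).trans_le
      (measure_mono (Set.subset_iUnion (fun n => forceRight (C n) m (j + n)) n))).ne' hB0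
  filter_upwards [hP.ae_exists_arrowTranslate_mem hBm hBpos] with a ha w
  -- The barrier of the translate sits at `m`, hence at `m + z` in `a`.
  obtain ⟨z, hz, hzB⟩ := ha (w - m)
  obtain ⟨N', hN', h0⟩ := hBbar _ hzB
  refine ⟨m + z, by omega, _, hN'.of_arrowTranslate, ?_⟩
  rw [add_sub_cancel_right]
  exact h0

/-! ### The pointwise ergodic theorem -/

section Birkhoff

variable {α : Type*} {T : α → α} {f : α → ℝ}

theorem birkhoffSum_le_partialSups {k n : ℕ} (h : k ≤ n) (x : α) :
    birkhoffSum T f k x ≤ partialSups (birkhoffSum T f) n x :=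
  le_partialSups_of_le (birkhoffSum T f) h x

theorem partialSups_birkhoffSum_nonneg (n : ℕ) (x : α) :
    0 ≤ partialSups (birkhoffSum T f) n x := by
  simpa using birkhoffSum_le_partialSups (T := T) (f := f) (Nat.zero_le n) x

/-- A positive maximum is not attained by the empty sum; removing the first term of the maximizing
sum leaves a Birkhoff sum at `T x`. -/
theorem partialSups_birkhoffSum_le (n : ℕ) {x : α} (h : 0 < partialSups (birkhoffSum T f) n x) :
    partialSups (birkhoffSum T f) n x ≤ f x + partialSups (birkhoffSum T f) n (T x) := by
  rw [Pi.partialSups_apply] at h ⊢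
  obtain ⟨k, hk, hkn⟩ := exists_partialSups_eq (fun i => birkhoffSum T f i x) n
  rw [hkn] at h ⊢
  cases k with
  | zero => simp at h
  | succ k =>
    rw [birkhoffSum_succ']
    gcongr
    exact birkhoffSum_le_partialSups (by omega) _

theorem birkhoffSum_sub_const (f : α → ℝ) (c : ℝ) (n : ℕ) (x : α) :
    birkhoffSum T (fun x => f x - c) n x = birkhoffSum T f n x - n * c := by
  simp [birkhoffSum, Finset.sum_sub_distrib]

variable [MeasurableSpace α] {μ : Measure α}

theorem measurable_birkhoffSum (hT : Measurable T) (hf : Measurable f) (n : ℕ) :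
    Measurable (birkhoffSum T f n) :=
  Finset.measurable_sum _ fun k _ => hf.comp (hT.iterate k)

theorem MeasureTheory.MeasurePreserving.integrable_birkhoffSum (hT : MeasurePreserving T μ μ)
    (hf : Integrable f μ) (n : ℕ) : Integrable (birkhoffSum T f n) μ :=
  integrable_finsetSum _ fun k _ => (hT.iterate k).integrable_comp_of_integrable hf

theorem MeasureTheory.MeasurePreserving.integrable_partialSups_birkhoffSum
    (hT : MeasurePreserving T μ μ) (hf : Integrable f μ) (n : ℕ) :
    Integrable (partialSups (birkhoffSum T f) n) μ := by
  induction n with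
  | zero => simp
  | succ n ih =>
    rw [partialSups_add_one]
    exact ih.sup (hT.integrable_birkhoffSum hf (n + 1))

/-- The maximal ergodic theorem. -/
theorem MeasureTheory.MeasurePreserving.setIntegral_nonneg_of_partialSups_birkhoffSum_pos
    (hT : MeasurePreserving T μ μ) (hf : Integrable f μ) (hfm : Measurable f) (n : ℕ) :
    0 ≤ ∫ x in {x | 0 < partialSups (birkhoffSum T f) n x}, f x ∂μ := by
  set M := partialSups (birkhoffSum T f) n with hM
  have hMi : Integrable M μ := hT.integrable_partialSups_birkhoffSum hf n
  have hMm : Measurable M := by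
    have : ∀ n, Measurable (partialSups (birkhoffSum T f) n) := fun n => by
      induction n with
      | zero => simpa using measurable_birkhoffSum hT.measurable hfm 0
      | succ n ih =>
        rw [partialSups_add_one]
        exact ih.sup (measurable_birkhoffSum hT.measurable hfm (n + 1))
    exact this n
  have hMT : Integrable (M ∘ T) μ := hT.integrable_comp_of_integrable hMi
  have hs : MeasurableSet {x | 0 < M x} := measurableSet_lt measurable_const hMm
  have h1 : ∫ x in {x | 0 < M x}, (M x - M (T x)) ∂μ ≤ ∫ x in {x | 0 < M x}, f x ∂μ := by
    refine setIntegral_mono_on (hMi.sub hMT).integrableOn hf.integrableOn hs fun x hx => ?_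
    have := partialSups_birkhoffSum_le n hx
    rw [← hM] at this
    linarith
  refine le_trans ?_ h1
  have hMi' : Integrable (fun x => M x) μ := hMi
  have hMT' : Integrable (fun x => M (T x)) μ := hMT
  rw [integral_sub hMi'.integrableOn hMT'.integrableOn]
  have h2 : ∫ x in {x | 0 < M x}, M x ∂μ = ∫ x, M x ∂μ := by
    refine setIntegral_eq_integral_of_forall_compl_eq_zero fun x hx => ?_
    exact le_antisymm (not_lt.1 hx) (partialSups_birkhoffSum_nonneg n x)
  have h3 : ∫ x in {x | 0 < M x}, M (T x) ∂μ ≤ ∫ x, M (T x) ∂μ :=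
    setIntegral_le_integral hMT' (ae_of_all _ fun x => partialSups_birkhoffSum_nonneg n _)
  have h4 : ∫ x, M (T x) ∂μ = ∫ x, M x ∂μ := by
    conv_rhs => rw [← hT.map_eq]
    rw [integral_map hT.measurable.aemeasurable hMm.aestronglyMeasurable]
  linarith

/-- Boundedness from above is an invariant event. If it failed almost surely, the sets in the
maximal ergodic theorem would exhaust the space, and its limit would give a nonnegative integral. -/
theorem Ergodic.ae_bddAbove_birkhoffSum [IsProbabilityMeasure μ] (hT : Ergodic T μ)
    (hfm : Measurable f) (hf : Integrable f μ) (hneg : ∫ x, f x ∂μ < 0) :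
    ∀ᵐ x ∂μ, ∃ C : ℕ, ∀ n, birkhoffSum T f n x ≤ C := by
  let E : Set α := {x | ∃ C : ℕ, ∀ n, birkhoffSum T f n x ≤ C}
  have hE : MeasurableSet E := by
    simp only [E, Set.ofPred_exists, Set.ofPred_forall]
    exact MeasurableSet.iUnion fun C => MeasurableSet.iInter fun n =>
      measurableSet_le (measurable_birkhoffSum hT.measurable hfm n) measurable_const
  have hinv : T ⁻¹' E = E := by
    ext x
    constructor
    · rintro ⟨C, hC⟩
      obtain ⟨D, hD⟩ := exists_nat_ge (f x + C)
      refine ⟨D, fun n => ?_⟩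
      cases n with
      | zero => simp
      | succ n => rw [birkhoffSum_succ']; linarith [hC n]
    · rintro ⟨C, hC⟩
      obtain ⟨D, hD⟩ := exists_nat_ge (C - f x)
      refine ⟨D, fun n => ?_⟩
      have := hC (n + 1)
      rw [birkhoffSum_succ'] at this
      linarith
  rcases hT.ae_mem_or_ae_notMem hE hinv with h | h
  · exact h
  exfalso
  have hlim : Tendsto (fun n => ∫ x in {x | 0 < partialSups (birkhoffSum T f) n x}, f x ∂μ) atTop
      (𝓝 (∫ x in ⋃ n, {x | 0 < partialSups (birkhoffSum T f) n x}, f x ∂μ)) := by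
    refine tendsto_setIntegral_of_monotone₀ (fun n => ?_) (fun m n hmn x hx => ?_) hf.integrableOn
    · exact nullMeasurableSet_lt aemeasurable_const
        (hT.toMeasurePreserving.integrable_partialSups_birkhoffSum hf n).aemeasurable
    · exact lt_of_lt_of_le hx ((partialSups (birkhoffSum T f)).monotone hmn x)
  have hall : ∫ x in ⋃ n, {x | 0 < partialSups (birkhoffSum T f) n x}, f x ∂μ = ∫ x, f x ∂μ := by
    conv_rhs => rw [← setIntegral_univ]
    refine setIntegral_congr_set ?_
    rw [ae_eq_univ, ← mem_ae_iff]
    filter_upwards [h] with x hx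
    by_contra hcon
    refine hx ⟨0, fun n => ?_⟩
    by_contra hlt
    rw [Nat.cast_zero, not_le] at hlt
    exact hcon (Set.mem_iUnion.2 ⟨n, hlt.trans_le (birkhoffSum_le_partialSups le_rfl x)⟩)
  rw [hall] at hlim
  exact absurd (ge_of_tendsto' hlim fun n =>
    hT.toMeasurePreserving.setIntegral_nonneg_of_partialSups_birkhoffSum_pos hf hfm n)
      (not_le.2 hneg)

/-- Bounded sums of `f - u k`, with `u k` decreasing to the integral, bound the averages by `u k + C
/ n`. -/
theorem Ergodic.ae_eventually_birkhoffSum_div_le [IsProbabilityMeasure μ] (hT : Ergodic T μ)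
    (hfm : Measurable f) (hf : Integrable f μ) :
    ∀ᵐ x ∂μ, ∀ c > ∫ x, f x ∂μ, ∀ᶠ n : ℕ in atTop, birkhoffSum T f n x / n < c := by
  obtain ⟨u, -, hu, hlim⟩ := exists_seq_strictAnti_tendsto (∫ x, f x ∂μ)
  have h : ∀ k, ∀ᵐ x ∂μ, ∃ C : ℕ, ∀ n, birkhoffSum T (fun x => f x - u k) n x ≤ C := fun k => by
    refine hT.ae_bddAbove_birkhoffSum (hfm.sub_const _) (hf.sub (integrable_const _)) ?_
    rw [integral_sub hf (integrable_const _)]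
    simpa using hu k
  filter_upwards [ae_all_iff.2 h] with x hx c hc
  obtain ⟨k, hk⟩ := (hlim.eventually_lt_const hc).exists
  obtain ⟨C, hC⟩ := hx k
  have hC0 : Tendsto (fun n : ℕ => (C : ℝ) / n) atTop (𝓝 0) :=
    tendsto_const_nhds.div_atTop tendsto_natCast_atTop_atTop
  filter_upwards [hC0.eventually_lt_const (sub_pos.2 hk), eventually_gt_atTop 0] with n hn hn0
  have hn0' : (0 : ℝ) < n := Nat.cast_pos.2 hn0
  have h1 := hC n
  rw [birkhoffSum_sub_const] at h1
  have h2 : birkhoffSum T f n x / n ≤ u k + C / n := by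
    rw [div_le_iff₀ hn0', add_mul, div_mul_cancel₀ _ hn0'.ne']
    linarith
  linarith

/-- **Birkhoff's pointwise ergodic theorem** for ergodic maps. -/
theorem Ergodic.ae_tendsto_birkhoffSum_div [IsProbabilityMeasure μ] (hT : Ergodic T μ)
    (hfm : Measurable f) (hf : Integrable f μ) :
    ∀ᵐ x ∂μ, Tendsto (fun n : ℕ => birkhoffSum T f n x / n) atTop (𝓝 (∫ x, f x ∂μ)) := by
  filter_upwards [hT.ae_eventually_birkhoffSum_div_le hfm hf,
    hT.ae_eventually_birkhoffSum_div_le (f := fun x => -f x) hfm.neg hf.neg] with x h1 h2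
  refine tendsto_order.2 ⟨fun c hc => ?_, fun c hc => h1 c hc⟩
  filter_upwards [h2 (-c) (by rw [integral_neg]; linarith)] with n hn
  have : birkhoffSum T (fun x => -f x) n x = -birkhoffSum T f n x := by
    simp [birkhoffSum]
  rw [this, neg_div] at hn
  linarith

/-- Birkhoff's theorem for positive functions that need not be integrable. -/
theorem Ergodic.exists_ae_tendsto_div_birkhoffSum [IsProbabilityMeasure μ] (hT : Ergodic T μ)
    (hfm : Measurable f) (h1 : ∀ᵐ x ∂μ, 1 ≤ f x) :
    ∃ v : ℝ, ∀ᵐ x ∂μ, Tendsto (fun n : ℕ => (n : ℝ) / birkhoffSum T f n x) atTop (𝓝 v) := by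
  by_cases hf : Integrable f μ
  · refine ⟨(∫ x, f x ∂μ)⁻¹, ?_⟩
    have hpos : 1 ≤ ∫ x, f x ∂μ := by
      simpa using integral_mono_ae (integrable_const 1) hf h1
    filter_upwards [hT.ae_tendsto_birkhoffSum_div hfm hf] with x hx
    simpa using hx.inv₀ (by positivity)
  -- Without integrability the truncations have unbounded integrals, so the averages diverge and the
  -- limit is `0`.
  · refine ⟨0, ?_⟩
    have hgi : ∀ K : ℕ, Integrable (fun x => min (f x) K) μ := fun K => by
      refine Integrable.of_bound (hfm.min measurable_const).aestronglyMeasurable K ?_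
      filter_upwards [h1] with x hx
      rw [Real.norm_of_nonneg (le_min (by linarith) K.cast_nonneg)]
      exact min_le_right _ _
    have hlarge : ∀ C : ℝ, ∃ K : ℕ, C < ∫ x, min (f x) K ∂μ := by
      intro C
      by_contra! hcon
      refine hf ?_
      refine ⟨hfm.aestronglyMeasurable, ?_⟩
      have hlim : ∀ x, Tendsto (fun K : ℕ => ENNReal.ofReal (min (f x) K)) atTop
          (𝓝 (ENNReal.ofReal (f x))) := fun x => by
        obtain ⟨K, hK⟩ := exists_nat_ge (f x)
        refine tendsto_const_nhds.congr' ?_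
        filter_upwards [eventually_ge_atTop K] with n hn
        rw [min_eq_left (hK.trans (Nat.cast_le.2 hn))]
      rw [hasFiniteIntegral_iff_ofReal (h1.mono fun x hx => zero_le_one.trans hx)]
      refine lt_of_le_of_lt ?_ (ENNReal.ofReal_lt_top (r := C))
      calc ∫⁻ x, ENNReal.ofReal (f x) ∂μ
          = ∫⁻ x, liminf (fun K : ℕ => ENNReal.ofReal (min (f x) K)) atTop ∂μ := by
            simp_rw [(hlim _).liminf_eq]
        _ ≤ liminf (fun K : ℕ => ∫⁻ x, ENNReal.ofReal (min (f x) K) ∂μ) atTop :=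
            lintegral_liminf_le fun K => (hfm.min measurable_const).ennreal_ofReal
        _ ≤ ENNReal.ofReal C := by
            refine liminf_le_of_le (by isBoundedDefault) fun b hb => ?_
            obtain ⟨K, hK⟩ := hb.exists
            refine hK.trans ?_
            rw [← ofReal_integral_eq_lintegral_ofReal (hgi K)]
            · exact ENNReal.ofReal_le_ofReal (hcon K)
            · filter_upwards [h1] with x hx
              exact le_min (zero_le_one.trans hx) K.cast_nonneg
    have hall : ∀ᵐ x ∂μ, ∀ K : ℕ, Tendsto
        (fun n : ℕ => birkhoffSum T (fun x => min (f x) K) n x / n) atTop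
          (𝓝 (∫ x, min (f x) K ∂μ)) :=
      ae_all_iff.2 fun K => hT.ae_tendsto_birkhoffSum_div (hfm.min measurable_const) (hgi K)
    filter_upwards [hall] with x hx
    have htop : Tendsto (fun n : ℕ => birkhoffSum T f n x / n) atTop atTop := by
      refine tendsto_atTop.2 fun C => ?_
      obtain ⟨K, hK⟩ := hlarge C
      filter_upwards [(hx K).eventually_const_lt hK] with n hn
      refine hn.le.trans ?_
      gcongr
      exact Finset.sum_le_sum fun i _ => min_le_left _ _
    refine htop.inv_tendsto_atTop.congr fun n => ?_
    simp

end Birkhoff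

/-! ### Speed from regeneration levels -/

/-- If `X` crosses each of the levels `z` with `p z` for good at time `S z`, these levels have a
positive density and `S n` grows like `n / v`, then `X` has speed `v`. -/
theorem tendsto_div_of_regeneration {X : ℕ → ℤ} (hX : Tendsto X atTop atTop) {S : ℕ → ℕ}
    {p : ℕ → Prop} [DecidablePred p] {q v : ℝ} (hq : 0 < q)
    (hp : Tendsto (fun n : ℕ => (Nat.count p n : ℝ) / n) atTop (𝓝 q))
    (hS : Tendsto (fun n : ℕ => (n : ℝ) / S n) atTop (𝓝 v)) {m : ℕ}
    (h : ∀ z ≥ m, p z → ∀ t, X t < z ↔ t < S z) :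
    Tendsto (fun t => (X t : ℝ) / t) atTop (𝓝 v) := by
  have hcount : Tendsto (Nat.count p) atTop atTop := by
    have h1 : Tendsto (fun n : ℕ => (Nat.count p n : ℝ) / n * n) atTop atTop :=
      hp.pos_mul_atTop hq tendsto_natCast_atTop_atTop
    refine tendsto_natCast_atTop_iff.1 (h1.congr' ?_)
    filter_upwards [eventually_gt_atTop 0] with n hn
    rw [div_mul_cancel₀ _ (Nat.cast_pos.2 hn).ne']
  have hinf : (Set.ofPred p).Infinite := by
    intro hfin
    obtain ⟨n, hn⟩ := (hcount.eventually_gt_atTop hfin.toFinset.card).exists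
    refine absurd hn (not_lt.2 ?_)
    rw [Nat.count_eq_card_filter_range]
    exact Finset.card_le_card fun i hi => by
      simpa using (Finset.mem_filter.1 hi).2
  set e : ℕ → ℕ := Nat.nth p with he
  have hemono : StrictMono e := Nat.nth_strictMono hinf
  have hep : ∀ i, p (e i) := Nat.nth_mem_of_infinite hinf
  have hetop : Tendsto e atTop atTop := hemono.tendsto_atTop
  have hie : Tendsto (fun i : ℕ => (i : ℝ) / e i) atTop (𝓝 q) := by
    refine (hp.comp hetop).congr fun i => ?_
    simp only [Function.comp, he, Nat.count_nth_of_infinite hinf]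
  -- `e (idx n)` is the first regeneration level above `n`, and `e (idx n - 1)` the last one not
  -- above `n`, as soon as `idx n ≥ 1`. Both are asymptotic to `n` because the levels have positive
  -- density.
  let idx : ℕ → ℕ := fun n => Nat.count p (n + 1)
  have hItop : Tendsto idx atTop atTop := hcount.comp (tendsto_add_atTop_nat 1)
  have hI1top : Tendsto (fun n => idx n - 1) atTop atTop := (tendsto_sub_atTop_nat 1).comp hItop
  have hIn : Tendsto (fun n : ℕ => (idx n : ℝ) / n) atTop (𝓝 q) := by
    have h1 : Tendsto (fun n : ℕ => (idx n : ℝ) / ((n + 1 : ℕ) : ℝ)) atTop (𝓝 q) :=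
      hp.comp (tendsto_add_atTop_nat 1)
    have h2 : Tendsto (fun n : ℕ => (((n + 1 : ℕ) : ℝ)) / n) atTop (𝓝 1) := by
      have := (tendsto_const_nhds (x := (1 : ℝ))).add (tendsto_one_div_atTop_nhds_zero_nat (𝕜 := ℝ))
      rw [add_zero] at this
      refine this.congr' ?_
      filter_upwards [eventually_gt_atTop 0] with n hn
      have : (n : ℝ) ≠ 0 := (Nat.cast_pos.2 hn).ne'
      push_cast
      field_simp
    have h3 := h1.mul h2
    rw [mul_one] at h3
    refine h3.congr fun n => ?_
    rw [div_mul_div_cancel₀ (Nat.cast_ne_zero.2 n.succ_ne_zero)]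
  have hI1n : Tendsto (fun n : ℕ => ((idx n - 1 : ℕ) : ℝ) / n) atTop (𝓝 q) := by
    have h1 := hIn.sub (tendsto_one_div_atTop_nhds_zero_nat (𝕜 := ℝ))
    rw [sub_zero] at h1
    refine h1.congr' ?_
    filter_upwards [hItop.eventually_ge_atTop 1] with n hn
    rw [Nat.cast_sub hn, Nat.cast_one, sub_div]
  have hone : ∀ {J : ℕ → ℕ}, Tendsto J atTop atTop →
      Tendsto (fun n : ℕ => (J n : ℝ) / n) atTop (𝓝 q) →
      Tendsto (fun n : ℕ => (n : ℝ) / S (e (J n))) atTop (𝓝 v) := by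
    intro J hJ hJn
    have h1 : Tendsto (fun n : ℕ => (n : ℝ) / J n) atTop (𝓝 q⁻¹) :=
      (hJn.inv₀ hq.ne').congr fun n => by simp
    have h2 := (h1.mul (hie.comp hJ)).mul (hS.comp (hetop.comp hJ))
    rw [inv_mul_cancel₀ hq.ne', one_mul] at h2
    refine h2.congr' ?_
    filter_upwards [hJ.eventually_gt_atTop 0] with n hn
    have h3 : (J n : ℝ) ≠ 0 := (Nat.cast_pos.2 hn).ne'
    have h4 : (e (J n) : ℝ) ≠ 0 :=
      (Nat.cast_pos.2 (hn.trans_le (hemono.le_apply))).ne'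
    simp only [Function.comp]
    rw [div_mul_div_cancel₀ h3, div_mul_div_cancel₀ h4]
  have hXn : Tendsto (fun t => (X t).toNat) atTop atTop := by
    refine tendsto_atTop.2 fun b => ?_
    filter_upwards [hX.eventually_ge_atTop (b : ℤ)] with t ht
    omega
  -- At time `t` the next level has not been crossed for good and the previous one has, so `t` lies
  -- between the two values of `S`.
  refine tendsto_of_tendsto_of_tendsto_of_le_of_le' ((hone hItop hIn).comp hXn)
    ((hone hI1top hI1n).comp hXn) ?_ ?_
  · filter_upwards [hX.eventually_ge_atTop 0, eventually_gt_atTop 0,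
      (hetop.comp (hItop.comp hXn)).eventually_ge_atTop m] with t h0 ht hm
    have hlt : (X t).toNat < e (idx (X t).toNat) := by
      by_contra hle
      have := Nat.count_monotone p (show e (idx (X t).toNat) + 1 ≤ (X t).toNat + 1 by omega)
      rw [Nat.count_succ, he, Nat.count_nth_of_infinite hinf, if_pos (hep _)] at this
      simp only [idx] at this
      omega
    have h1 := (h _ hm (hep _) t).1 (by simp only [Function.comp]; omega)
    simp only [Function.comp] at h1 ⊢
    have h2 : ((X t).toNat : ℝ) = X t := by exact_mod_cast Int.toNat_of_nonneg h0
    rw [h2]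
    have h3 : (0 : ℝ) ≤ X t := by exact_mod_cast h0
    gcongr
  · filter_upwards [hX.eventually_ge_atTop 0, (hItop.comp hXn).eventually_ge_atTop 1,
      (hetop.comp (hI1top.comp hXn)).eventually_ge_atTop m,
      (hetop.comp (hI1top.comp hXn)).eventually_gt_atTop (X 0).toNat] with t h0 hI hm hm0
    simp only [Function.comp] at hI hm hm0 ⊢
    have hle : e (idx (X t).toNat - 1) ≤ (X t).toNat := by
      have hpos : 1 ≤ Nat.count p ((X t).toNat + 1) := hI
      have hlt : Nat.count p ((X t).toNat + 1) - 1 < Nat.count p ((X t).toNat + 1) := by omega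
      exact Nat.lt_succ_iff.1 (Nat.nth_lt_of_lt_count hlt)
    have h1 := (h _ hm (hep _) 0).1 (by omega)
    have h4 := (not_congr (h _ hm (hep _) t)).1 (by omega)
    have h2 : ((X t).toNat : ℝ) = X t := by exact_mod_cast Int.toNat_of_nonneg h0
    rw [h2]
    have h3 : (0 : ℝ) ≤ X t := by exact_mod_cast h0
    have h5 : (0 : ℝ) < S (e (idx (X t).toNat - 1)) := Nat.cast_pos.2 h1
    gcongr
    exact not_lt.1 h4

/-! ### Crossing times of the walk -/

/-- Each unit of time spent below `z` is one departure from a site in `[w, z)`. -/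
theorem sum_localTime_walk (c : ArrowEnv) {w : ℤ} (hw : ∀ t, w ≤ walk c t) (z : ℤ) (t : ℕ) :
    ∑ y ∈ Finset.Ico w z, (mobState (fun _ => (0 : Fin 1)) (fun _ => 0) c t).2 y =
      Nat.count (fun s => walk c s < z) t := by
  induction t with
  | zero => simp [mobState]
  | succ t ih =>
    simp only [mobState_succ_snd, Finset.sum_add_distrib, ih, Nat.count_succ, Finset.sum_ite_eq,
      Finset.mem_Ico]
    have : w ≤ (mobState (fun _ => (0 : Fin 1)) (fun _ => 0) c t).1 0 := hw t
    simp only [this, true_and]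
    rfl

/-- A barrier `z` is crossed for good after as many steps as there are departures from the sites
to the left of `z`. -/
theorem walk_lt_barrier_iff {c : ArrowEnv} (hc : WalkRightTransient c) {w : ℤ}
    (hw : ∀ t, w ≤ walk c t) {z : ℤ} {N : ℤ → ℕ} (hN : SuperSol 1 z c N)
    (h0 : leftCount c z (N z) = 0) (t : ℕ) :
    walk c t < z ↔ t < ∑ y ∈ Finset.Ico w z, walkDepartures c y := by
  obtain ⟨T, hT⟩ := (hc.eventually_ge_atTop z).exists
  have hex : ∃ T, z ≤ walk c T := ⟨T, hT⟩
  classical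
  -- Once the barrier is reached the walk never returns below it, so the times spent below `z` form
  -- an initial segment.
  have hiff : ∀ s, walk c s < z ↔ s < Nat.find hex := fun s => by
    constructor
    · intro hs
      by_contra hle
      exact absurd (hN.le_mobState h0 (Nat.find_spec hex) (not_lt.1 hle)) (not_le.2 hs)
    · exact fun hs => not_le.1 (Nat.find_min hex hs)
  have hev : ∀ᶠ s in atTop, ∀ y ∈ Finset.Ico w z,
      (mobState (fun _ => (0 : Fin 1)) (fun _ => 0) c s).2 y = walkDepartures c y :=
    (Filter.eventually_all_finset _).2 fun y _ =>
      ((walk_mobTendsto_iff.2 hc).eventually y).mono fun s hs => hs.2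
  obtain ⟨s, hs, hsT⟩ := (hev.and (eventually_ge_atTop (Nat.find hex))).exists
  have hsum := sum_localTime_walk c hw z s
  rw [Finset.sum_congr rfl hs] at hsum
  have hcount : Nat.count (fun s => walk c s < z) s = Nat.find hex := by
    simp only [hiff, Nat.count_eq_card_filter_range]
    rw [show (Finset.range s).filter (fun r => r < Nat.find hex) = Finset.range (Nat.find hex) by
      ext r; simp only [Finset.mem_filter, Finset.mem_range]; omega, Finset.card_range]
  rw [hsum, hcount, hiff]

theorem exists_le_walk {c : ArrowEnv} (hc : WalkRightTransient c) :
    ∃ w ≤ 0, ∀ t, w ≤ walk c t := by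
  obtain ⟨s, hs⟩ := Filter.Tendsto.exists_forall_le (f := walk c)
    (by rw [Nat.cofinite_eq_atTop]; exact hc)
  exact ⟨min (walk c s) 0, min_le_right _ _, fun t => (min_le_left _ _).trans (hs t)⟩

/-! ### Stationarity of the local times -/

theorem leftCount_arrowTranslate (z y : ℤ) (a : ArrowEnv) (n : ℕ) :
    leftCount (arrowTranslate z a) y n = leftCount a (y + z) n := rfl

theorem rightCount_arrowTranslate (z y : ℤ) (a : ArrowEnv) (n : ℕ) :
    rightCount (arrowTranslate z a) y n = rightCount a (y + z) n := rfl

theorem SuperSol.arrowTranslate {j : ℕ} {m : ℤ} {a : ArrowEnv} {N : ℤ → ℕ}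
    (h : SuperSol j m a N) (z : ℤ) :
    SuperSol j (m - z) (arrowTranslate z a) fun y => N (y + z) := by
  intro y hy
  have h1 := h (y + z) (by omega)
  rw [leftCount_arrowTranslate, rightCount_arrowTranslate]
  rw [add_right_comm] at h1 ⊢
  dsimp only
  rw [add_right_comm]
  exact h1

theorem HasBarriers.arrowTranslate {j : ℕ} {a : ArrowEnv} (h : HasBarriers j a) (z : ℤ) :
    HasBarriers j (arrowTranslate z a) := fun w => by
  obtain ⟨y, hy, N, hN, h0⟩ := h (w + z)
  refine ⟨y - z, by omega, _, hN.arrowTranslate z, ?_⟩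
  rwa [leftCount_arrowTranslate, sub_add_cancel]

/-- Instead of comparing trajectories, the local time profile of each mob is translated into a
supersolution for the other. -/
theorem totalDepartures_arrowTranslate {j : ℕ} {S : ℕ → Fin j} (hS : ProperScheduling S)
    {a : ArrowEnv} (h : HasBarriers j a) (z : ℤ) :
    totalDepartures S (fun _ => 0) (arrowTranslate z a) 0 =
      totalDepartures S (fun _ => z) a z := by
  refine le_antisymm ?_ ?_
  · have h1 := ((h.mobTendsto hS fun _ => z).superSol fun _ => le_rfl).arrowTranslate z
    rw [sub_self] at h1
    simpa using h1.totalDepartures_le (S := S) (x := fun _ => 0) le_rfl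
  · have h1 := (((h.arrowTranslate z).mobTendsto hS fun _ => 0).superSol
      fun _ => le_rfl).of_arrowTranslate
    rw [zero_add] at h1
    simpa using h1.totalDepartures_le (S := S) (x := fun _ => z) le_rfl

/-- The number of departures from `0` of one more walker after `k` walkers, all from `0`. -/
noncomputable def extraDepartures {k : ℕ} (S : ℕ → Fin k) (S' : ℕ → Fin (k + 1))
    (a : ArrowEnv) : ℕ :=
  totalDepartures S' (fun _ => 0) a 0 - totalDepartures S (fun _ => 0) a 0

/-- None of `k + 1` walkers started from `0` steps to the left of `0`. -/
def IsBarrier {k : ℕ} (S' : ℕ → Fin (k + 1)) (a : ArrowEnv) : Prop :=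
  leftCount a 0 (totalDepartures S' (fun _ => 0) a 0) = 0

section Extra

variable {k : ℕ} {S : ℕ → Fin k} {S' : ℕ → Fin (k + 1)} {a : ArrowEnv} {x : Fin k → ℤ}

theorem superSol_extra (hS : ProperScheduling S) (hS' : ProperScheduling S')
    (h : HasBarriers (k + 1) a) (x : Fin k → ℤ) (y : ℤ) :
    SuperSol 1 y (leftover S x a)
      fun z => totalDepartures S' (fun _ => y) a z - totalDepartures S x a z :=
  ((h.mobTendsto hS' fun _ => y).superSol fun _ => le_rfl).leftover
    ((h.mono k.le_succ).mobTendsto hS x)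

theorem extraDepartures_arrowTranslate (hS : ProperScheduling S) (hS' : ProperScheduling S')
    (h : HasBarriers (k + 1) a) {y : ℤ} (hx : ∀ i, x i ≤ y) :
    extraDepartures S S' (arrowTranslate y a) =
      totalDepartures S' (fun _ => y) a y - totalDepartures S x a y := by
  have ht := (h.mono k.le_succ).mobTendsto hS
  rw [extraDepartures, totalDepartures_arrowTranslate hS' h,
    totalDepartures_arrowTranslate hS (h.mono k.le_succ),
    totalDepartures_congr (ht x) (ht fun _ => y) hx fun _ => le_rfl]

theorem isBarrier_arrowTranslate (hS' : ProperScheduling S') (h : HasBarriers (k + 1) a) (y : ℤ) :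
    IsBarrier S' (arrowTranslate y a) ↔
      leftCount a y (totalDepartures S' (fun _ => y) a y) = 0 := by
  rw [IsBarrier, leftCount_arrowTranslate, totalDepartures_arrowTranslate hS' h, zero_add]

/-- The supersolution of order one on the leftover forces at least one right arrow at the origin. -/
theorem one_le_extraDepartures (hS : ProperScheduling S) (hS' : ProperScheduling S')
    (h : HasBarriers (k + 1) a) : 1 ≤ extraDepartures S S' a := by
  have h1 := superSol_extra hS hS' h (fun _ => 0) 0 0 le_rfl
  have h2 := rightCount_add_leftCount (leftover S (fun _ => 0) a) 0 (extraDepartures S S' a)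
  simp only [extraDepartures] at h1 h2 ⊢
  omega

/-- Minimality in both directions: the difference of the two mobs bounds the walk, and the `k`-mob
plus the walk bounds the `(k + 1)`-mob. This makes the walk's departures a stationary sequence
beyond `m`. -/
theorem walkDepartures_eq_extraDepartures (hS : ProperScheduling S) (hS' : ProperScheduling S')
    (h : HasBarriers (k + 1) a) {c : ArrowEnv} (hc : WalkRightTransient c) {m : ℤ}
    (hm : ∀ i, x i ≤ m) (hm0 : 0 ≤ m)
    (hac : ∀ y, m ≤ y → ∀ i, leftover S x a (y, i) = c (y, i)) {y : ℤ} (hy : m ≤ y) :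
    walkDepartures c y = extraDepartures S S' (arrowTranslate y a) := by
  have hxy : ∀ i, x i ≤ y := fun i => (hm i).trans hy
  rw [extraDepartures_arrowTranslate hS hS' h hxy]
  have ht := (h.mono k.le_succ).mobTendsto hS x
  refine le_antisymm ?_ ?_
  · exact ((superSol_extra hS hS' h x y).congr fun z hz => hac z
      (hy.trans hz)).totalDepartures_le le_rfl
  · have h1 := ((superSol_add_walkDepartures ht hc hm hm0 hac).mono le_rfl hy).totalDepartures_le
      (S := S') (x := fun _ => y) le_rfl
    omega

theorem IsBarrier.exists_superSol (hS : ProperScheduling S) (hS' : ProperScheduling S')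
    (h : HasBarriers (k + 1) a) {c : ArrowEnv} {m : ℤ}
    (hac : ∀ y, m ≤ y → ∀ i, leftover S x a (y, i) = c (y, i)) {z : ℤ} (hz : m ≤ z)
    (hb : IsBarrier S' (arrowTranslate z a)) :
    ∃ N, SuperSol 1 z c N ∧ leftCount c z (N z) = 0 := by
  refine ⟨_, (superSol_extra hS hS' h x z).congr fun y hy => hac y (hz.trans hy), ?_⟩
  rw [← leftCount_congr (hac z hz)]
  refine leftCount_leftover_eq_zero ?_ ((isBarrier_arrowTranslate hS' h z).1 hb)
  exact (((h.mobTendsto hS' fun _ => z).superSol fun _ => le_rfl).mono k.le_succ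
    le_rfl).totalDepartures_le le_rfl

/-- The local time of the actual mob is below any supersolution, so a barrier certified by some
profile is one for the minimal profile. -/
theorem HasBarriers.exists_isBarrier (hS' : ProperScheduling S') (h : HasBarriers (k + 1) a) :
    ∃ z, IsBarrier S' (_root_.arrowTranslate z a) := by
  obtain ⟨z, -, N, hN, h0⟩ := h 0
  refine ⟨z, (isBarrier_arrowTranslate hS' h z).2 ?_⟩
  have := leftCount_mono a z (hN.totalDepartures_le (S := S') (x := fun _ => z) le_rfl)
  omega

end Extra

/-! ### The law of large numbers -/

theorem iterate_arrowTranslate (n : ℕ) (a : ArrowEnv) :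
    (arrowTranslate 1)^[n] a = arrowTranslate n a := by
  induction n with
  | zero => simp [arrowTranslate_zero]
  | succ n ih =>
    rw [Function.iterate_succ_apply', ih, arrowTranslate_add, add_comm, Nat.cast_succ]

theorem tendsto_div_add_const {B : ℕ → ℝ} (hB : Tendsto B atTop atTop) {v : ℝ}
    (h : Tendsto (fun n : ℕ => (n : ℝ) / B n) atTop (𝓝 v)) (D : ℝ) :
    Tendsto (fun n : ℕ => (n : ℝ) / (B n + D)) atTop (𝓝 v) := by
  have h1 : Tendsto (fun n => 1 + D / B n) atTop (𝓝 (1 + 0)) :=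
    tendsto_const_nhds.add (tendsto_const_nhds.div_atTop hB)
  have h2 := h.div h1 (by norm_num)
  rw [add_zero, div_one] at h2
  refine h2.congr' ?_
  filter_upwards [hB.eventually_gt_atTop 0] with n hn
  simp only [Pi.div_apply]
  rw [div_div, mul_add, mul_one, mul_div_cancel₀ _ hn.ne']

theorem tendsto_walk_div {k : ℕ} {S : ℕ → Fin k} {S' : ℕ → Fin (k + 1)}
    (hS : ProperScheduling S) (hS' : ProperScheduling S') {a : ArrowEnv}
    (h : HasBarriers (k + 1) a) {q v : ℝ} (hq : 0 < q) [DecidablePred (IsBarrier S')]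
    (hp : Tendsto (fun n => (Nat.count (fun n : ℕ => IsBarrier S' (arrowTranslate n a)) n : ℝ) / n)
      atTop (𝓝 q))
    (hv : Tendsto (fun n : ℕ => (n : ℝ) /
      ∑ y ∈ Finset.range n, (extraDepartures S S' (arrowTranslate y a) : ℝ)) atTop (𝓝 v))
    {c : ArrowEnv} (hc : WalkRightTransient c) {x : Fin k → ℤ} {m : ℕ} (hm : ∀ i, x i ≤ m)
    (hac : ∀ y : ℤ, m ≤ y → ∀ i, leftover S x a (y, i) = c (y, i)) :
    Tendsto (fun n : ℕ => (walk c n : ℝ) / n) atTop (𝓝 v) := by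
  obtain ⟨w, hw0, hw⟩ := exists_le_walk hc
  have hm0 : (0 : ℤ) ≤ m := Int.natCast_nonneg m
  refine tendsto_div_of_regeneration hc (p := fun n : ℕ => IsBarrier S' (arrowTranslate n a))
    (S := fun n => ∑ y ∈ Finset.Ico w (n : ℤ), walkDepartures c y) hq hp ?_ (m := m)
    fun z hz hb t => ?_
  · let M : ℕ → ℝ := fun y => extraDepartures S S' (arrowTranslate y a)
    have hM : ∀ y, 1 ≤ M y := fun y => by
      exact Nat.one_le_cast.2 (one_le_extraDepartures hS hS' (h.arrowTranslate y))
    have hB : Tendsto (fun n => ∑ y ∈ Finset.range n, M y) atTop atTop := by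
      refine tendsto_atTop_mono (fun n => ?_) (tendsto_natCast_atTop_atTop (R := ℝ))
      simpa using Finset.card_nsmul_le_sum (Finset.range n) M 1 fun y _ => hM y
    -- Beyond `m` each new site adds the same term to both sums, so they differ by a constant, which
    -- does not affect the limit.
    refine (tendsto_div_add_const hB hv (((∑ y ∈ Finset.Ico w (m : ℤ), walkDepartures c y : ℕ) : ℝ)
      - ∑ y ∈ Finset.range m, M y)).congr' ?_
    filter_upwards [eventually_ge_atTop m] with n hn
    congr 1
    induction n, hn using Nat.le_induction with
    | base => ring
    | succ n hn ih =>
      rw [Finset.sum_range_succ, Nat.cast_succ (R := ℤ), ← Finset.insert_Ico_right_eq_Ico_add_one (by omega),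
        Finset.sum_insert Finset.right_notMem_Ico, Nat.cast_add, ← ih,
        walkDepartures_eq_extraDepartures hS hS' h hc hm hm0 hac (by omega)]
      simp only [M]
      ring
  · obtain ⟨N, hN, h0⟩ := IsBarrier.exists_superSol hS hS' h hac (z := z) (by omega) hb
    exact walk_lt_barrier_iff hc hw hN h0 t

theorem measurable_totalDepartures {k : ℕ} (S : ℕ → Fin k) (x : Fin k → ℤ) (y : ℤ) :
    Measurable fun a => totalDepartures S x a y :=
  (measurable_of_countable ENat.toNat).comp (measurable_mobLocalTime S x y)

theorem measurable_leftCount (y : ℤ) (n : ℕ) : Measurable fun a => leftCount a y n := by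
  induction n with
  | zero => simp [leftCount]
  | succ n ih =>
    simp only [leftCount_succ]
    exact ih.add (Measurable.ite (measurableSet_eq_fun (measurable_pi_apply (y, n)) measurable_const)
      measurable_const measurable_const)

theorem measurableSet_isBarrier {k : ℕ} (S' : ℕ → Fin (k + 1)) :
    MeasurableSet {a | IsBarrier S' a} :=
  measurableSet_eq_fun (measurable_eval_countable (f := fun a n => leftCount a 0 n)
    (fun n => measurable_leftCount 0 n) (measurable_totalDepartures S' (fun _ => 0) 0))
    measurable_const

/-- The exceptional null set and `v` are fixed before `c` and `x`, which gives one speed for all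
leftovers simultaneously. The schedule `S'` is auxiliary. -/
theorem StationaryErgodic.exists_speed {P : Measure CookieEnv} [IsProbabilityMeasure P]
    (hP : StationaryErgodic P) {k : ℕ} {S : ℕ → Fin k} {S' : ℕ → Fin (k + 1)}
    (hS : ProperScheduling S) (hS' : ProperScheduling S')
    (h : ∀ᵐ a ∂annealedArrowLaw P, HasBarriers (k + 1) a) :
    ∃ v : ℝ, ∀ᵐ a ∂annealedArrowLaw P, ∀ c, WalkRightTransient c → ∀ (x : Fin k → ℤ) (m : ℕ),
      (∀ i, x i ≤ m) → (∀ y : ℤ, m ≤ y → ∀ i, leftover S x a (y, i) = c (y, i)) →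
        Tendsto (fun n : ℕ => (walk c n : ℝ) / n) atTop (𝓝 v) := by
  classical
  have hT := hP.ergodic_arrowTranslate
  have hBm := measurableSet_isBarrier S'
  have hMm : Measurable fun a => (extraDepartures S S' a : ℝ) :=
    (measurable_of_countable (Nat.cast : ℕ → ℝ)).comp
      ((measurable_totalDepartures S' _ 0).sub (measurable_totalDepartures S _ 0))
  obtain ⟨v, hv⟩ := hT.exists_ae_tendsto_div_birkhoffSum hMm (h.mono fun a ha => by
    exact_mod_cast one_le_extraDepartures hS hS' ha)
  have hpos : 0 < (annealedArrowLaw P).real {a | IsBarrier S' a} := by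
    rw [measureReal_def, ENNReal.toReal_pos_iff]
    refine ⟨pos_iff_ne_zero.2 fun h0 => ?_, measure_lt_top _ _⟩
    -- If barriers had density zero, stationarity would exclude them at every site, against
    -- `HasBarriers`.
    have hall : ∀ᵐ a ∂annealedArrowLaw P, ∀ z, ¬ IsBarrier S' (arrowTranslate z a) :=
      ae_all_iff.2 fun z => (hP.measurePreserving_arrowTranslate z).quasiMeasurePreserving.ae
        (measure_eq_zero_iff_ae_notMem.1 h0)
    obtain ⟨a, ha, hb⟩ := (hall.and h).exists
    obtain ⟨z, hz⟩ := hb.exists_isBarrier hS'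
    exact ha z hz
  have hq := hT.ae_tendsto_birkhoffSum_div
    (f := Set.indicator {a | IsBarrier S' a} fun _ => (1 : ℝ))
    (measurable_const.indicator hBm) ((integrable_const 1).indicator hBm)
  rw [integral_indicator_const _ hBm, smul_eq_mul, mul_one] at hq
  refine ⟨v, ?_⟩
  filter_upwards [h, hv, hq] with a ha hva hqa c hc x m hm hac
  refine tendsto_walk_div hS hS' ha hpos (hqa.congr fun n => ?_) (hva.congr fun n => ?_) hc hm hac
  · rw [birkhoffSum, Nat.count_eq_card_filter_range, Finset.card_filter, Nat.cast_sum]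
    congr 1
    refine Finset.sum_congr rfl fun i _ => ?_
    rw [iterate_arrowTranslate]
    simp [Set.indicator_apply]
  · simp only [birkhoffSum, iterate_arrowTranslate]

/-! ### Equivalent descriptions of strong right transience -/

theorem exists_properScheduling (k : ℕ) : ∃ S : ℕ → Fin (k + 1), ProperScheduling S := by
  refine ⟨fun t => Fin.ofNat (k + 1) t, fun i => ?_⟩
  refine Set.infinite_of_injective_forall_mem (f := fun n : ℕ => (i : ℕ) + (k + 1) * n)
    (fun m n h => ?_) fun n => ?_
  · simpa using h
  · ext
    simp [Nat.mod_eq_of_lt i.2]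

theorem measurableSet_walkRightTransient : MeasurableSet {a | WalkRightTransient a} := by
  have hw : ∀ t, Measurable fun a => walk a t := fun t => (measurable_mobState _ _ t).1 0
  simp only [WalkRightTransient, tendsto_atTop, eventually_atTop, Set.ofPred_forall,
    Set.ofPred_exists]
  exact MeasurableSet.iInter fun K => MeasurableSet.iUnion fun T => MeasurableSet.iInter fun t =>
    MeasurableSet.iInter fun _ => measurableSet_le measurable_const (hw t)

theorem StronglyRightTransient.ae_hasBarriers [IsProbabilityMeasure P]
    (hSE : StationaryErgodic P) (hWEL : WeaklyElliptic P) {k : ℕ}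
    (h : StronglyRightTransient P (k + 1)) : ∀ᵐ a ∂annealedArrowLaw P, HasBarriers (k + 1) a := by
  obtain ⟨S', hS'⟩ := exists_properScheduling k
  -- With `m = -1` the half-line `[m + 1, ∞)` starts at the common starting point `0`.
  refine hSE.ae_hasBarriers hWEL (m := -1) (N := totalDepartures S' fun _ => 0)
    (measurable_totalDepartures S' _ _) ?_
  filter_upwards [h] with a ha
  exact MobTendsto.superSol (fun i => ha _ S' hS' i) fun _ => by norm_num

theorem ae_hasBarriers_of_walkRightTransient [IsProbabilityMeasure P]
    (hSE : StationaryErgodic P) (hWEL : WeaklyElliptic P) {k : ℕ} {S : ℕ → Fin k}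
    {x : Fin k → ℤ} {c : ArrowEnv → ArrowEnv} (hc : Measurable c) {m : ℤ} (hm : ∀ i, x i ≤ m)
    (hm0 : 0 ≤ m) (h : ∀ᵐ a ∂annealedArrowLaw P, MobTendsto S x a ∧ WalkRightTransient (c a) ∧
      ∀ y, m ≤ y → ∀ i, leftover S x a (y, i) = c a (y, i)) :
    ∀ᵐ a ∂annealedArrowLaw P, HasBarriers (k + 1) a := by
  refine hSE.ae_hasBarriers hWEL (m := m - 1)
    (N := fun a y => totalDepartures S x a y + walkDepartures (c a) y) ?_ ?_
  · exact (measurable_totalDepartures S x _).add ((measurable_totalDepartures _ _ _).comp hc)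
  · filter_upwards [h] with a ha
    rw [sub_add_cancel]
    exact superSol_add_walkDepartures ha.1 ha.2.1 hm hm0 ha.2.2

theorem exists_nat_bound {k : ℕ} (x : Fin k → ℤ) : ∃ m : ℕ, ∀ i, x i ≤ m := by
  obtain ⟨B, hB⟩ := (Set.finite_range x).bddAbove
  exact ⟨B.toNat, fun i => (hB ⟨i, rfl⟩).trans (Int.self_le_toNat B)⟩

/-! ### The equivalence and the common speed -/

/-- The existence of `S : ℕ → Fin k` already forces `k ≥ 1`. -/
theorem mainTheorem8 (P : Measure CookieEnv) [IsProbabilityMeasure P]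
    (hSE : StationaryErgodic P) (hND : NonDegenerate P) (hWEL : WeaklyElliptic P)
    (k : ℕ) (S : ℕ → Fin k) (hS : ProperScheduling S) :
    List.TFAE [
      StronglyRightTransient P (k + 1),
      ∃ x : Fin k → ℤ, (∀ᵐ a ∂annealedArrowLaw P, MobRightTransient x a) ∧
        ∀ᵐ b ∂leftoverLaw P S x, WalkRightTransient b,
      StronglyRightTransient P k ∧ ∀ᵐ b ∂limitLeftoverLaw P S, WalkRightTransient b] ∧
    (StronglyRightTransient P (k + 1) →
      ∃ v : ℝ, ∀ᵐ a ∂annealedArrowLaw P,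
        Tendsto (fun n : ℕ => (walk (limitLeftover S a) n : ℝ) / n) atTop (𝓝 v) ∧
        ∀ x : Fin k → ℤ,
          Tendsto (fun n : ℕ => (walk (leftover S x a) n : ℝ) / n) atTop (𝓝 v)) := by
  have hlim : ∀ {a}, (∀ x : Fin k → ℤ, MobTendsto S x a) → ∀ y : ℤ, 0 ≤ y → ∀ i,
      leftover S (fun _ => 0) a (y, i) = limitLeftover S a (y, i) := fun h y hy =>
    leftover_eq_limitLeftover (h _) (h _) fun _ => hy
  have strong : (∀ᵐ a ∂annealedArrowLaw P, HasBarriers (k + 1) a) →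
      StronglyRightTransient P (k + 1) := fun h => by
    filter_upwards [h] with a ha x using ha.mobRightTransient x
  constructor
  · tfae_have 1 → 2 := fun h => by
      have hb := h.ae_hasBarriers hSE hWEL
      refine ⟨fun _ => 0, ?_, ?_⟩
      · filter_upwards [hb] with a ha using (ha.mono k.le_succ).mobRightTransient _
      · rw [leftoverLaw, ae_map_iff (measurable_leftover S _).aemeasurable
          measurableSet_walkRightTransient]
        filter_upwards [hb] with a ha using (ha.leftover hS _).walkRightTransient
    tfae_have 1 → 3 := fun h => by
      have hb := h.ae_hasBarriers hSE hWEL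
      refine ⟨?_, ?_⟩
      · filter_upwards [hb] with a ha x using (ha.mono k.le_succ).mobRightTransient x
      · rw [limitLeftoverLaw, ae_map_iff (measurable_limitLeftover S).aemeasurable
          measurableSet_walkRightTransient]
        filter_upwards [hb] with a ha using (ha.limitLeftover hS).walkRightTransient
    tfae_have 2 → 1 := fun ⟨x, hx, hwalk⟩ => by
      obtain ⟨m, hm⟩ := exists_nat_bound x
      refine strong (ae_hasBarriers_of_walkRightTransient hSE hWEL (S := S)
        (measurable_leftover S x) hm (Int.natCast_nonneg m) ?_)
      filter_upwards [hx, ae_of_ae_map (measurable_leftover S x).aemeasurable hwalk] with a h1 h2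
      exact ⟨fun i => h1 S hS i, h2, fun _ _ _ => rfl⟩
    tfae_have 3 → 1 := fun ⟨hk, hwalk⟩ => by
      refine strong (ae_hasBarriers_of_walkRightTransient hSE hWEL (S := S) (x := fun _ => 0)
        (measurable_limitLeftover S) (fun _ => le_rfl) le_rfl ?_)
      filter_upwards [hk, ae_of_ae_map (measurable_limitLeftover S).aemeasurable hwalk]
        with a h1 h2
      exact ⟨fun i => h1 _ S hS i, h2, hlim fun x i => h1 x S hS i⟩
    tfae_finish
  · intro h
    have hb := h.ae_hasBarriers hSE hWEL
    obtain ⟨S', hS'⟩ := exists_properScheduling k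
    obtain ⟨v, hv⟩ := hSE.exists_speed hS hS' hb
    refine ⟨v, ?_⟩
    filter_upwards [hb, hv] with a ha hva
    refine ⟨hva _ (ha.limitLeftover hS).walkRightTransient (fun _ => 0) 0 (fun _ => le_rfl)
      (hlim ((ha.mono k.le_succ).mobTendsto hS)), fun x => ?_⟩
    obtain ⟨m, hm⟩ := exists_nat_bound x
    exact hva _ (ha.leftover hS x).walkRightTransient x m hm fun _ _ _ => rfl
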